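/- Let $k$ be an algebraically closed field, let $Q$ be a finite connected (non-empty) quiver and let $\Lambda = kQ/I$, where $I$ is an admissible ideal of the path algebra $kQ$ that is generated by paths of length $2$ (so $\Lambda$ is a quadratic monomial algebra). For integers $r,s\ge 1$, the $(r,s)$-star quiver $S_{(r,s)}$ is the quiver with $r+s+1$ vertices: a central vertex $z$, vertices $1,\dots,r$ with one arrow $a_i\colon i\to z$ each, and vertices $1',\dots,s'$ with one arrow $b_j\colon z\to j'$ each. (1) If $\Lambda$ has global dimension $2$ and $\operatorname{Ext}^1_{\Lambda^e}(\Lambda,\Lambda^e)=0$, where $\Lambda^e=\Lambda\otimes_k\Lambda^{\mathrm{op}}$, then $Q$ is isomorphic to $S_{(r,s)}$ for some $r,s\ge 1$. (2) In particular, suppose that $\Lambda$ is $2$-hereditary, that is, $\Lambda$ is finite-dimensional of global dimension $2$ and $H^j(\mathbb S_2^i(\Lambda))=0$ for all $i,j\in\mathbb Z$ with $j\notin 2\mathbb Z$, where $\mathbb S_2=\mathbb S\circ[-2]$ and $\mathbb S=D\Lambda\otimes^{\mathbf L}_\Lambda-$ is the Serre functor of $D^b(\mathsf{mod}\,\Lambda)$,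 with inverse $\mathbf R\mathrm{Hom}_\Lambda(D\Lambda,-)$ and $D=\mathrm{Hom}_k(-,k)$. Then, for some $r,s\ge 1$, $Q\cong S_{(r,s)}$ and $\Lambda\cong kS_{(r,s)}/J$ as $k$-algebras for an admissible ideal $J$ generated by paths of length $2$. -/

import Mathlib

open CategoryTheory

universe u

noncomputable section

namespace StarCor

/-! ### Path algebras and bound quiver algebras -/

/-- The type of all paths (of any length `≥ 0`) of a quiver, with their tail and their head:
`⟨i, j, p⟩` is a path `p` with tail `i` and head `j`. -/
abbrev QPath (V : Type) [Quiver.{0} V] : Type := Σ i : V, Σ j : V, Quiver.Path i j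

/-- The path algebra `kQ`: formal `k`-linear combinations of paths. -/
def PathAlgebra (k : Type u) (V : Type) [Quiver.{0} V] [Field k] : Type u := QPath V →₀ k

namespace PathAlgebra

variable (k : Type u) [Field k] {V : Type} [Quiver.{0} V]

instance : AddCommGroup (PathAlgebra k V) := inferInstanceAs (AddCommGroup (QPath V →₀ k))

instance : Module k (PathAlgebra k V) := inferInstanceAs (Module k (QPath V →₀ k))

/-- The basis element of `kQ` given by a path. -/
def ofPath (p : QPath V) : PathAlgebra k V := Finsupp.single p (1 : k)

open Classical in
/-- The product `p * q` of two paths is "`q` followed by `p`" if the head of `q` is the tail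
of `p`, and it is `0` otherwise. -/
def pathMul (p q : QPath V) : PathAlgebra k V :=
  if h : q.2.1 = p.1 then
    ofPath k ⟨q.1, p.2.1, q.2.2.comp (p.2.2.cast h.symm rfl)⟩
  else 0

/-- The bilinear extension of the product of paths. -/
def mulLin : PathAlgebra k V →ₗ[k] PathAlgebra k V →ₗ[k] PathAlgebra k V :=
  Finsupp.linearCombination k fun p : QPath V =>
    (Finsupp.linearCombination k (pathMul k p) : (QPath V →₀ k) →ₗ[k] PathAlgebra k V)

instance : Mul (PathAlgebra k V) := ⟨fun x y => mulLin k x y⟩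

/-- The unit of `kQ` is the sum of the trivial paths `e_i`. -/
instance [Fintype V] : One (PathAlgebra k V) :=
  ⟨∑ i : V, ofPath k ⟨i, i, Quiver.Path.nil⟩⟩

theorem mul_def (x y : PathAlgebra k V) : x * y = mulLin k x y := rfl

theorem one_def [Fintype V] :
    (1 : PathAlgebra k V) = ∑ i : V, ofPath k ⟨i, i, Quiver.Path.nil⟩ := rfl

theorem ofPath_mul_ofPath (p q : QPath V) : ofPath k p * ofPath k q = pathMul k p q := by
  have h₁ : mulLin k (ofPath k p) = (Finsupp.linearCombination k (pathMul k p) :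
      (QPath V →₀ k) →ₗ[k] PathAlgebra k V) :=
    (Finsupp.linearCombination_single k _ _).trans (one_smul k _)
  change mulLin k (ofPath k p) (ofPath k q) = _
  rw [h₁]
  exact (Finsupp.linearCombination_single k _ _).trans (one_smul k _)

theorem pathMul_mk {i j l : V} (p : Quiver.Path i j) (q : Quiver.Path j l) :
    pathMul k ⟨j, l, q⟩ ⟨i, j, p⟩ = ofPath k ⟨i, l, p.comp q⟩ := by
  simp [pathMul]

theorem pathMul_ne (p q : QPath V) (h : q.2.1 ≠ p.1) : pathMul k p q = 0 := by
  simp [pathMul, h]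

variable {k} in
theorem induction_on {P : PathAlgebra k V → Prop} (x : PathAlgebra k V) (h0 : P 0)
    (hadd : ∀ x y, P x → P y → P (x + y)) (hs : ∀ (c : k) (p : QPath V), P (c • ofPath k p)) :
    P x := by
  refine Finsupp.induction_linear (motive := P) x h0 (fun f g => hadd f g) (fun p c => ?_)
  have h := hs c p
  have e : c • ofPath k p = (Finsupp.single p c : QPath V →₀ k) := by
    change c • (Finsupp.single p (1 : k) : QPath V →₀ k) = _
    simp
  rwa [e] at h

theorem ofPath_assoc (p q r : QPath V) :
    ofPath k p * ofPath k q * ofPath k r = ofPath k p * (ofPath k q * ofPath k r) := by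
  obtain ⟨p₁, p₂, p⟩ := p
  obtain ⟨q₁, q₂, q⟩ := q
  obtain ⟨r₁, r₂, r⟩ := r
  by_cases h₁ : q₂ = p₁
  · subst h₁
    by_cases h₂ : r₂ = q₁
    · subst h₂
      simp [ofPath_mul_ofPath, pathMul_mk, Quiver.Path.comp_assoc]
    · rw [ofPath_mul_ofPath, pathMul_mk, ofPath_mul_ofPath, pathMul_ne _ _ _ h₂,
        ofPath_mul_ofPath, pathMul_ne _ _ _ h₂]
      simp [mul_def]
  · by_cases h₂ : r₂ = q₁
    · subst h₂
      rw [ofPath_mul_ofPath k ⟨r₂, q₂, q⟩, pathMul_mk, ofPath_mul_ofPath, pathMul_ne _ _ _ h₁,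
        ofPath_mul_ofPath, pathMul_ne _ _ _ h₁]
      simp [mul_def]
    · rw [ofPath_mul_ofPath, pathMul_ne _ _ _ h₁, ofPath_mul_ofPath, pathMul_ne _ _ _ h₂]
      simp [mul_def]

instance : NonUnitalRing (PathAlgebra k V) where
  left_distrib x y z := by simp [mul_def]
  right_distrib x y z := by simp [mul_def]
  zero_mul x := by simp [mul_def]
  mul_zero x := by simp [mul_def]
  mul_assoc x y z := by
    have hsl : ∀ (c : k) (x y : PathAlgebra k V), (c • x) * y = c • (x * y) := by simp [mul_def]
    have hsr : ∀ (c : k) (x y : PathAlgebra k V), x * (c • y) = c • (x * y) := by simp [mul_def]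
    have hal : ∀ x y z : PathAlgebra k V, (x + y) * z = x * z + y * z := by simp [mul_def]
    have har : ∀ x y z : PathAlgebra k V, x * (y + z) = x * y + x * z := by simp [mul_def]
    have hzl : ∀ x : PathAlgebra k V, 0 * x = 0 := by simp [mul_def]
    have hzr : ∀ x : PathAlgebra k V, x * 0 = 0 := by simp [mul_def]
    induction x using induction_on with
    | h0 => simp [hzl]
    | hadd a b ha hb => simp only [hal, ha, hb]
    | hs c p =>
      induction y using induction_on with
      | h0 => simp [hzl, hzr]
      | hadd a b ha hb => simp only [hal, har, ha, hb]
      | hs d q =>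
        induction z using induction_on with
        | h0 => simp [hzr]
        | hadd a b ha hb => simp only [har, ha, hb]
        | hs e r => simp only [hsl, hsr, ofPath_assoc]

variable [Fintype V]

theorem one_mul_ofPath (p : QPath V) : 1 * ofPath k p = ofPath k p := by
  classical
  obtain ⟨i, j, p⟩ := p
  rw [one_def, Finset.sum_mul, Finset.sum_eq_single j]
  · rw [ofPath_mul_ofPath, pathMul_mk, Quiver.Path.comp_nil]
  · intro l _ hl
    rw [ofPath_mul_ofPath, pathMul_ne _ _ _ (Ne.symm hl)]
  · simp

theorem ofPath_mul_one (p : QPath V) : ofPath k p * 1 = ofPath k p := by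
  classical
  obtain ⟨i, j, p⟩ := p
  rw [one_def, Finset.mul_sum, Finset.sum_eq_single i]
  · rw [ofPath_mul_ofPath, pathMul_mk, Quiver.Path.nil_comp]
  · intro l _ hl
    rw [ofPath_mul_ofPath, pathMul_ne _ _ _ hl]
  · simp

instance : Ring (PathAlgebra k V) :=
  { (inferInstance : NonUnitalRing (PathAlgebra k V)) with
    one := 1
    one_mul := fun x => by
      have hsr : ∀ (c : k) (x y : PathAlgebra k V), x * (c • y) = c • (x * y) := by
        simp [mul_def]
      induction x using induction_on with
      | h0 => exact mul_zero _
      | hadd a b ha hb => rw [mul_add, ha, hb]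
      | hs c p => rw [hsr, one_mul_ofPath]
    mul_one := fun x => by
      have hsl : ∀ (c : k) (x y : PathAlgebra k V), (c • x) * y = c • (x * y) := by
        simp [mul_def]
      induction x using induction_on with
      | h0 => exact zero_mul _
      | hadd a b ha hb => rw [add_mul, ha, hb]
      | hs c p => rw [hsl, ofPath_mul_one] }

instance : Algebra k (PathAlgebra k V) :=
  Algebra.ofModule (fun c x y => by simp [mul_def]) (fun c x y => by simp [mul_def])

end PathAlgebra

section BoundQuiver

variable {k : Type u} [Field k] {V : Type} [Quiver.{0} V] [Fintype V]

/-- The two-sided ideal of `kQ` generated by a set of paths. -/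
def pathIdeal (k : Type u) [Field k] (M : Set (QPath V)) : TwoSidedIdeal (PathAlgebra k V) :=
  TwoSidedIdeal.span (PathAlgebra.ofPath k '' M)

/-- `I` is admissible: `𝒥 ^ m ⊆ I ⊆ 𝒥 ^ 2` for some `m ≥ 2`, where `𝒥` is the arrow ideal
(so that `𝒥 ^ l` is generated by the paths of length `l`). -/
def IsAdmissible (I : TwoSidedIdeal (PathAlgebra k V)) : Prop :=
  I ≤ pathIdeal k {p | p.2.2.length = 2} ∧
    ∃ m : ℕ, 2 ≤ m ∧ pathIdeal k {p | p.2.2.length = m} ≤ I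

/-- `I` is generated by paths of length two. -/
def IsQuadraticMonomial (I : TwoSidedIdeal (PathAlgebra k V)) : Prop :=
  ∃ M : Set (QPath V), (∀ p ∈ M, p.2.2.length = 2) ∧ I = pathIdeal k M

/-- The quotient algebra `kQ / I`. -/
abbrev BoundQuiverAlgebra (I : TwoSidedIdeal (PathAlgebra k V)) : Type u := I.ringCon.Quotient

end BoundQuiver

/-! ### Star quivers -/

/-- The `r + s + 1` vertices of the `(r, s)`-star quiver. -/
inductive StarVertex (r s : ℕ) : Type
  | source (i : Fin r) : StarVertex r s
  | center : StarVertex r s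
  | sink (j : Fin s) : StarVertex r s
  deriving Fintype

/-- The arrows `a_i : i → z` and `b_j : z → j` of the `(r, s)`-star quiver. -/
inductive StarArrow (r s : ℕ) : StarVertex r s → StarVertex r s → Type
  | a (i : Fin r) : StarArrow r s (StarVertex.source i) StarVertex.center
  | b (j : Fin s) : StarArrow r s StarVertex.center (StarVertex.sink j)

instance (r s : ℕ) : Quiver.{0} (StarVertex r s) := ⟨StarArrow r s⟩

/-! ### Global dimension and Hochschild-type extension groups -/

/-- The (left) global dimension of a ring: the supremum of the projective dimensions of its left
modules. -/
def globalDimension (R : Type u) [Ring R] : WithBot ℕ∞ :=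
  ⨆ M : ModuleCat.{u} R, projectiveDimension M

section Enveloping

open scoped TensorProduct

variable (k : Type u) [Field k] (Λ : Type u) [Ring Λ] [Algebra k Λ]

/-- The enveloping algebra `Λ^e = Λ ⊗_k Λ^op`. -/
abbrev Env : Type u := Λ ⊗[k] Λᵐᵒᵖ

/-- `Λ` as a left `Λ^e`-module, `(a ⊗ b) • x = a * x * b`. -/
def regularBimodule : ModuleCat.{u} (Env k Λ) :=
  letI : Module (Env k Λ) Λ := TensorProduct.Algebra.module
  ModuleCat.of (Env k Λ) Λ

/-- `Ext^l_{Λ^e}(Λ, Λ^e)`. -/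
abbrev ExtEnv (l : ℕ) : Type u :=
  Abelian.Ext (regularBimodule k Λ) (ModuleCat.of (Env k Λ) (Env k Λ)) l

end Enveloping

/-! ### The bimodule `DΛ` and the two functors `DΛ ⊗_Λ -` and `Hom_Λ(DΛ, -)` -/

section Dual

variable (k : Type u) [Field k] (Λ : Type u) [Ring Λ] [Algebra k Λ]

/-- The `k`-dual `DΛ = Hom_k(Λ, k)`. -/
def DualBimodule : Type u := Λ →ₗ[k] k

instance : AddCommGroup (DualBimodule k Λ) := inferInstanceAs (AddCommGroup (Λ →ₗ[k] k))

instance : FunLike (DualBimodule k Λ) Λ k := inferInstanceAs (FunLike (Λ →ₗ[k] k) Λ k)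

/-- The left action `(a φ)(x) = φ (x a)`. -/
instance : Module Λ (DualBimodule k Λ) where
  smul a φ := LinearMap.comp (M₂ := Λ) φ (LinearMap.mulRight k a)
  one_smul φ := LinearMap.ext fun x => congrArg φ (mul_one x)
  mul_smul a b φ := LinearMap.ext fun x => congrArg φ (mul_assoc x a b).symm
  smul_zero _ := rfl
  smul_add _ _ _ := rfl
  add_smul a b φ := LinearMap.ext fun x =>
    (congrArg φ (mul_add x a b)).trans (LinearMap.map_add φ _ _)
  zero_smul φ := LinearMap.ext fun x =>
    (congrArg φ (mul_zero x)).trans (LinearMap.map_zero φ)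

/-- The right action `(φ a)(x) = φ (a x)`. -/
instance : Module Λᵐᵒᵖ (DualBimodule k Λ) where
  smul a φ := LinearMap.comp (M₂ := Λ) φ (LinearMap.mulLeft k a.unop)
  one_smul φ := LinearMap.ext fun x => congrArg φ (one_mul x)
  mul_smul a b φ := LinearMap.ext fun x =>
    congrArg φ (mul_assoc b.unop a.unop x)
  smul_zero _ := rfl
  smul_add _ _ _ := rfl
  add_smul a b φ := LinearMap.ext fun x =>
    (congrArg φ (add_mul a.unop b.unop x)).trans (LinearMap.map_add φ _ _)
  zero_smul φ := LinearMap.ext fun x =>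
    (congrArg φ (zero_mul x)).trans (LinearMap.map_zero φ)

theorem smul_apply (a : Λ) (φ : DualBimodule k Λ) (x : Λ) : (a • φ) x = φ (x * a) := rfl

theorem op_smul_apply (a : Λ) (φ : DualBimodule k Λ) (x : Λ) :
    (MulOpposite.op a • φ) x = φ (a * x) := rfl

instance : SMulCommClass Λ Λᵐᵒᵖ (DualBimodule k Λ) where
  smul_comm a b φ := LinearMap.ext fun x => congrArg φ (mul_assoc b.unop x a).symm

end Dual

section Functors

open scoped TensorProduct

variable {Λ : Type u} [Ring Λ] (B : Type u) [AddCommGroup B] [Module Λ B] [Module Λᵐᵒᵖ B]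
  [SMulCommClass Λ Λᵐᵒᵖ B]

/-- The relations `φ a ⊗ m = φ ⊗ a m` which are divided out of `B ⊗_ℤ M` to get `B ⊗_Λ M`. -/
def balancing (M : ModuleCat.{u} Λ) : Submodule Λ (B ⊗[ℤ] M) :=
  Submodule.span Λ {x | ∃ (φ : B) (a : Λ) (m : M),
    x = (MulOpposite.op a • φ) ⊗ₜ[ℤ] m - φ ⊗ₜ[ℤ] (a • m)}

/-- The map `B ⊗_ℤ M → B ⊗_ℤ N` induced by `f : M → N`. -/
def tensorMapAux {M N : ModuleCat.{u} Λ} (f : M ⟶ N) : B ⊗[ℤ] M →ₗ[Λ] B ⊗[ℤ] N :=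
  TensorProduct.AlgebraTensorModule.map (LinearMap.id : B →ₗ[Λ] B) (f.hom.restrictScalars ℤ)

theorem tensorMapAux_tmul {M N : ModuleCat.{u} Λ} (f : M ⟶ N) (φ : B) (m : M) :
    tensorMapAux B f (φ ⊗ₜ[ℤ] m) = φ ⊗ₜ[ℤ] (f.hom m) := rfl

theorem balancing_le_comap {M N : ModuleCat.{u} Λ} (f : M ⟶ N) :
    balancing B M ≤ (balancing B N).comap (tensorMapAux B f) := by
  refine Submodule.span_le.2 ?_
  rintro _ ⟨φ, a, m, rfl⟩
  refine Submodule.subset_span ⟨φ, a, f.hom m, ?_⟩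
  rw [map_sub, tensorMapAux_tmul, tensorMapAux_tmul, map_smul]

theorem quotient_tmul_ext {M : ModuleCat.{u} Λ} {N : Type u} [AddCommGroup N] [Module Λ N]
    {f g : ((B ⊗[ℤ] M) ⧸ balancing B M) →ₗ[Λ] N}
    (h : ∀ φ m, f ((balancing B M).mkQ (φ ⊗ₜ[ℤ] m)) = g ((balancing B M).mkQ (φ ⊗ₜ[ℤ] m))) :
    f = g := by
  refine Submodule.linearMap_qext _ (LinearMap.ext fun x => ?_)
  induction x using TensorProduct.induction_on with
  | zero => simp
  | tmul φ m => exact h φ m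
  | add x y hx hy => rw [map_add, map_add, hx, hy]

/-- The functor `B ⊗_Λ -` on left modules, for a `Λ`-`Λ`-bimodule `B`. -/
def tensorFunctor : ModuleCat.{u} Λ ⥤ ModuleCat.{u} Λ where
  obj M := ModuleCat.of Λ ((B ⊗[ℤ] M) ⧸ balancing B M)
  map {M N} f := ModuleCat.ofHom
    (Submodule.mapQ (balancing B M) (balancing B N) (tensorMapAux B f) (balancing_le_comap B f))
  map_id M := by
    refine ModuleCat.hom_ext (quotient_tmul_ext B fun φ m => ?_)
    rfl
  map_comp f g := by
    refine ModuleCat.hom_ext (quotient_tmul_ext B fun φ m => ?_)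
    rfl

instance : (tensorFunctor (Λ := Λ) B).Additive where
  map_add {M N f g} := by
    refine ModuleCat.hom_ext (quotient_tmul_ext B fun φ m => ?_)
    change (balancing B N).mkQ (φ ⊗ₜ[ℤ] (f.hom m + g.hom m)) =
      (balancing B N).mkQ (φ ⊗ₜ[ℤ] f.hom m) + (balancing B N).mkQ (φ ⊗ₜ[ℤ] g.hom m)
    rw [TensorProduct.tmul_add, map_add]

/-- The group `Hom_Λ(B, M)` of left `Λ`-linear maps, for a `Λ`-`Λ`-bimodule `B`. -/
def BimodHom (B : Type u) [AddCommGroup B] [Module Λ B] (M : Type u) [AddCommGroup M]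
    [Module Λ M] : Type u := B →ₗ[Λ] M

instance (M : Type u) [AddCommGroup M] [Module Λ M] : AddCommGroup (BimodHom (Λ := Λ) B M) :=
  inferInstanceAs (AddCommGroup (B →ₗ[Λ] M))

instance (M : Type u) [AddCommGroup M] [Module Λ M] : FunLike (BimodHom (Λ := Λ) B M) B M :=
  inferInstanceAs (FunLike (B →ₗ[Λ] M) B M)

/-- The left `Λ`-module structure on `Hom_Λ(B, M)`, `(a f)(φ) = f (φ a)`. -/
instance (M : Type u) [AddCommGroup M] [Module Λ M] : Module Λ (BimodHom (Λ := Λ) B M) where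
  smul a f :=
    { toFun := fun φ => f (MulOpposite.op a • φ)
      map_add' := fun φ ψ => by rw [smul_add]; exact LinearMap.map_add f _ _
      map_smul' := fun b φ => by rw [← smul_comm]; exact LinearMap.map_smul f _ _ }
  one_smul f := LinearMap.ext fun φ => congrArg f (one_smul Λᵐᵒᵖ φ)
  mul_smul a b f := LinearMap.ext fun φ =>
    congrArg f (mul_smul (MulOpposite.op b) (MulOpposite.op a) φ)
  smul_zero _ := rfl
  smul_add _ _ _ := rfl
  add_smul a b f := LinearMap.ext fun φ =>
    (congrArg f (add_smul (MulOpposite.op a) (MulOpposite.op b) φ)).trans (LinearMap.map_add f _ _)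
  zero_smul f := LinearMap.ext fun φ =>
    (congrArg f (zero_smul Λᵐᵒᵖ φ)).trans (LinearMap.map_zero f)

/-- The functor `Hom_Λ(B, -)` on left modules, for a `Λ`-`Λ`-bimodule `B`. -/
def homFunctor : ModuleCat.{u} Λ ⥤ ModuleCat.{u} Λ where
  obj M := ModuleCat.of Λ (BimodHom (Λ := Λ) B M)
  map {M N} f := ModuleCat.ofHom (X := BimodHom (Λ := Λ) B M) (Y := BimodHom (Λ := Λ) B N)
    { toFun := fun g => LinearMap.comp (M₂ := M) f.hom g
      map_add' := fun g h => LinearMap.comp_add (M₂ := M) g h f.hom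
      map_smul' := fun _ _ => rfl }
  map_id _ := rfl
  map_comp _ _ := rfl

instance : (homFunctor (Λ := Λ) B).Additive where
  map_add {_ _ _ _} := ModuleCat.hom_ext (LinearMap.ext fun _ => LinearMap.ext fun _ => rfl)

end Functors

/-! ### The Serre functor and `n`-hereditary algebras -/

section Hereditary

attribute [local instance] HasDerivedCategory.standard

variable (k : Type u) [Field k] (Λ : Type u) [Ring Λ] [Algebra k Λ]

/-- `K` is a bounded complex of finitely generated `Λ`-modules all of which satisfy `P`. -/
def IsBoundedComplexOf {Λ : Type u} [Ring Λ] (P : ModuleCat.{u} Λ → Prop)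
    (K : CochainComplex (ModuleCat.{u} Λ) ℤ) : Prop :=
  (∀ n, P (K.X n) ∧ Module.Finite Λ (K.X n)) ∧
    ∃ N : ℤ, ∀ n, N < |n| → Limits.IsZero (K.X n)

/-- `Y ≅ 𝕊 X`, where `𝕊 = DΛ ⊗^𝐋_Λ -` is computed by means of a bounded complex of finitely
generated projective modules isomorphic to `X` in the derived category. If `Λ` is
finite-dimensional of finite global dimension, then every object of `D^b(mod Λ)` is isomorphic
to such a complex. -/
def IsSerre (X Y : DerivedCategory (ModuleCat.{u} Λ)) : Prop :=
  ∃ P : CochainComplex (ModuleCat.{u} Λ) ℤ, IsBoundedComplexOf (fun M => Projective M) P ∧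
    Nonempty (DerivedCategory.Q.obj P ≅ X) ∧
    Nonempty (DerivedCategory.Q.obj
      (((tensorFunctor (Λ := Λ) (DualBimodule k Λ)).mapHomologicalComplex _).obj P) ≅ Y)

/-- `Y ≅ 𝕊⁻¹ X`, where `𝕊⁻¹ = 𝐑Hom_Λ(DΛ, -)` is computed by means of a bounded complex of
finitely generated injective modules isomorphic to `X` in the derived category. If `Λ` is
finite-dimensional of finite global dimension, then every object of `D^b(mod Λ)` is isomorphic
to such a complex. -/
def IsSerreInv (X Y : DerivedCategory (ModuleCat.{u} Λ)) : Prop :=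
  ∃ I : CochainComplex (ModuleCat.{u} Λ) ℤ, IsBoundedComplexOf (fun M => Injective M) I ∧
    Nonempty (DerivedCategory.Q.obj I ≅ X) ∧
    Nonempty (DerivedCategory.Q.obj
      (((homFunctor (Λ := Λ) (DualBimodule k Λ)).mapHomologicalComplex _).obj I) ≅ Y)

/-- The family `X i ≅ 𝕊 ^ i Λ`, `i ∈ ℤ`, of objects of `D^b(mod Λ)`; it is determined up to
isomorphism. -/
structure IsSerreOrbit (X : ℤ → DerivedCategory (ModuleCat.{u} Λ)) : Prop where
  zero : Nonempty (X 0 ≅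
    (DerivedCategory.singleFunctor (ModuleCat.{u} Λ) 0).obj (ModuleCat.of Λ Λ))
  succ : ∀ i : ℕ, IsSerre k Λ (X i) (X (i + 1))
  pred : ∀ i : ℕ, IsSerreInv k Λ (X (-i)) (X (-i - 1))

/-- `Λ` is `n`-hereditary: it is a finite-dimensional algebra of global dimension `n`, and
`H^j(𝕊_n ^ i Λ) = 0` for all `i, j ∈ ℤ` with `j ∉ n ℤ`, where `𝕊_n = 𝕊 ∘ [-n]`, so that
`𝕊_n ^ i Λ = (𝕊 ^ i Λ)[-n i]`. -/
def IsNHereditary (n : ℕ) : Prop :=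
  Module.Finite k Λ ∧ globalDimension Λ = n ∧
    ∃ X : ℤ → DerivedCategory (ModuleCat.{u} Λ), IsSerreOrbit k Λ X ∧
      ∀ i j : ℤ, ¬ (n : ℤ) ∣ j →
        Limits.IsZero ((DerivedCategory.homologyFunctor (ModuleCat.{u} Λ) j).obj
          ((shiftFunctor (DerivedCategory (ModuleCat.{u} Λ)) (-(n * i))).obj (X i)))

end Hereditary

end StarCor

end

/-!
A derivation `D : Λ → Λ ⊗ Λ` and a linear form `φ` on `Λ` give the contraction `x ↦ φ (D x)` of the
second tensor factor. As a function of `x` and `φ` it is a cocycle for an extension of `DΛ` by `Λ`,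
and both cohomological conditions force this cocycle to be inner. If `Ext¹` vanishes, then `D`
itself is inner. If `Λ` is `2`-hereditary, then the complex of homomorphisms from `DΛ` into the
injective complex computing `𝕊₂⁻¹ Λ` is exact in degree one, which splits the extension.

Let `Λ` be quadratic monomial and let `D` vanish on all arrows except one arrow `a : i ⟶ j`. That
the contractions of `D` are inner is then a condition on weights of the vertices. Taking
`D a = e_j ⊗ e_i` shows that `a` is part of a relation, taking `D a = a ⊗ e_i` that `i` is a source
with the single arrow `a` unless a relation ends with `a`, and taking `D a = e_j ⊗ a` the dual
statement. In global dimension two no arrow is both the end of a relation and the beginning of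
another one. Hence every arrow starts at a source or ends at a sink which lies on no other arrow,
and a connected quiver of this kind which has a path of length two is a star.
-/

noncomputable section

namespace StarCor

/-! ### Universal properties of path algebras and of bound quiver algebras -/

section PathRep

open PathAlgebra

variable {k : Type u} [Field k] {V : Type} [Quiver.{0} V]

theorem PathAlgebra.linearMap_ext {N : Type*} [AddCommMonoid N] [Module k N]
    {f g : PathAlgebra k V →ₗ[k] N} (h : ∀ p, f (ofPath k p) = g (ofPath k p)) : f = g :=
  Finsupp.lhom_ext' fun p => LinearMap.ext_ring (h p)

/-- A representation of a quiver in a ring `A`: orthogonal idempotents of sum one for the vertices,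
and for each arrow an element of the corresponding Peirce component. -/
structure PathRep (V : Type) [Quiver.{0} V] [Fintype V] (A : Type*) [Ring A] where
  /-- The idempotent at a vertex. -/
  vertex : V → A
  complete : CompleteOrthogonalIdempotents vertex
  /-- The element representing an arrow. -/
  arrow : ∀ {i j : V}, (i ⟶ j) → A
  vertex_mul_arrow : ∀ {i j : V} (b : i ⟶ j), vertex j * arrow b = arrow b
  arrow_mul_vertex : ∀ {i j : V} (b : i ⟶ j), arrow b * vertex i = arrow b

namespace PathRep

variable [Fintype V] {A : Type*} [Ring A] (ρ : PathRep V A)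

/-- The product of the arrows of a path; as in `PathAlgebra`, the last arrow is the left factor. -/
def eval {i : V} : ∀ {j : V}, Quiver.Path i j → A
  | _, .nil => ρ.vertex i
  | _, .cons p b => ρ.arrow b * eval p

theorem vertex_mul_eval {i j : V} (p : Quiver.Path i j) : ρ.vertex j * ρ.eval p = ρ.eval p := by
  cases p with
  | nil => exact ρ.complete.idem i
  | cons p b => rw [eval, ← mul_assoc, ρ.vertex_mul_arrow]

theorem eval_mul_vertex {i j : V} (p : Quiver.Path i j) : ρ.eval p * ρ.vertex i = ρ.eval p := by
  induction p with
  | nil => exact ρ.complete.idem i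
  | cons p b ih => rw [eval, mul_assoc, ih]

theorem eval_comp {i j l : V} (p : Quiver.Path i j) (q : Quiver.Path j l) :
    ρ.eval (p.comp q) = ρ.eval q * ρ.eval p := by
  induction q with
  | nil => rw [Quiver.Path.comp_nil, eval, vertex_mul_eval]
  | cons q b ih => rw [Quiver.Path.comp_cons, eval, eval, ih, mul_assoc]

theorem eval_mul_eval_of_ne {i j i' j' : V} (p : Quiver.Path i j) (q : Quiver.Path i' j')
    (h : j' ≠ i) : ρ.eval p * ρ.eval q = 0 := by
  rw [← ρ.eval_mul_vertex p, ← ρ.vertex_mul_eval q, mul_assoc, ← mul_assoc (ρ.vertex i),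
    ρ.complete.ortho h.symm, zero_mul, mul_zero]

variable [Algebra k A]

/-- The linear extension of `PathRep.eval` to the path algebra. -/
def liftLinear (ρ : PathRep V A) : PathAlgebra k V →ₗ[k] A :=
  Finsupp.linearCombination k fun p : QPath V => ρ.eval p.2.2

theorem liftLinear_ofPath (p : QPath V) :
    ρ.liftLinear (ofPath k p) = ρ.eval p.2.2 :=
  (Finsupp.linearCombination_single k _ _).trans (one_smul k _)

theorem liftLinear_pathMul (p q : QPath V) :
    ρ.liftLinear (pathMul k p q) = ρ.eval p.2.2 * ρ.eval q.2.2 := by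
  obtain ⟨i, j, p⟩ := p
  obtain ⟨i', j', q⟩ := q
  by_cases h : j' = i
  · subst h
    rw [pathMul_mk, liftLinear_ofPath, eval_comp]
  · rw [pathMul_ne k _ _ h, map_zero, ρ.eval_mul_eval_of_ne p q h]

/-- The algebra homomorphism out of the path algebra given by a representation. -/
def lift : PathAlgebra k V →ₐ[k] A :=
  AlgHom.ofLinearMap ρ.liftLinear
    (by simp only [one_def, map_sum, liftLinear_ofPath, eval, ρ.complete.complete])
    (fun x y => by
      have h : (mulLin k).compr₂ ρ.liftLinear =
          (LinearMap.mul k A).compl₁₂ ρ.liftLinear ρ.liftLinear :=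
        PathAlgebra.linearMap_ext fun p => PathAlgebra.linearMap_ext fun q => by
          simpa only [LinearMap.compr₂_apply, LinearMap.compl₁₂_apply, LinearMap.mul_apply',
            liftLinear_ofPath, ← mul_def, ofPath_mul_ofPath] using ρ.liftLinear_pathMul p q
      exact LinearMap.congr_fun₂ h x y)

theorem lift_ofPath (p : QPath V) : ρ.lift (ofPath k p) = ρ.eval p.2.2 :=
  ρ.liftLinear_ofPath p

end PathRep

end PathRep

section BoundQuiver

open PathAlgebra

variable {k : Type u} [Field k] {V : Type} [Quiver.{0} V]

/-- The path of length two consisting of `a` followed by `b`. -/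
def twoPath {i j l : V} (a : i ⟶ j) (b : j ⟶ l) : QPath V := ⟨i, l, a.toPath.cons b⟩

theorem exists_eq_twoPath {p : QPath V} (hp : p.2.2.length = 2) :
    ∃ (i j l : V) (a : i ⟶ j) (b : j ⟶ l), p = twoPath a b := by
  obtain ⟨i, l, p⟩ := p
  match p, hp with
  | .cons (.cons .nil a) b, _ => exact ⟨_, _, _, a, b, rfl⟩

variable [Fintype V]

/-- The idempotent `e_i` of a bound quiver algebra. -/
def vertexElt (I : TwoSidedIdeal (PathAlgebra k V)) (i : V) : BoundQuiverAlgebra I :=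
  I.ringCon.mkₐ k (ofPath k ⟨i, i, .nil⟩)

/-- The class of an arrow in a bound quiver algebra. -/
def arrowElt (I : TwoSidedIdeal (PathAlgebra k V)) {i j : V} (b : i ⟶ j) : BoundQuiverAlgebra I :=
  I.ringCon.mkₐ k (ofPath k ⟨i, j, b.toPath⟩)

section

variable (I : TwoSidedIdeal (PathAlgebra k V))

theorem completeOrthogonalIdempotents_vertexElt :
    CompleteOrthogonalIdempotents (vertexElt I) where
  idem i := by
    rw [IsIdempotentElem, vertexElt, ← map_mul, ofPath_mul_ofPath, pathMul_mk,
      Quiver.Path.comp_nil]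
  ortho i j h := by
    dsimp only [vertexElt]
    rw [← map_mul, ofPath_mul_ofPath, pathMul_ne k _ _ h.symm, map_zero]
  complete := by
    simp only [vertexElt]
    rw [← map_sum, ← one_def, map_one]

/-- The tautological representation of a quiver in a bound quiver algebra. -/
def boundRep : PathRep V (BoundQuiverAlgebra I) where
  vertex := vertexElt I
  complete := completeOrthogonalIdempotents_vertexElt I
  arrow := arrowElt I
  vertex_mul_arrow b := by
    rw [vertexElt, arrowElt, ← map_mul, ofPath_mul_ofPath, pathMul_mk, Quiver.Path.comp_nil]
  arrow_mul_vertex b := by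
    rw [vertexElt, arrowElt, ← map_mul, ofPath_mul_ofPath, pathMul_mk, Quiver.Path.nil_comp]

theorem vertexElt_mul_self (i : V) : vertexElt I i * vertexElt I i = vertexElt I i :=
  (completeOrthogonalIdempotents_vertexElt I).idem i

theorem vertexElt_mul_arrowElt {i j : V} (b : i ⟶ j) :
    vertexElt I j * arrowElt I b = arrowElt I b :=
  (boundRep I).vertex_mul_arrow b

theorem arrowElt_mul_vertexElt {i j : V} (b : i ⟶ j) :
    arrowElt I b * vertexElt I i = arrowElt I b :=
  (boundRep I).arrow_mul_vertex b

theorem mk_ofPath {i j : V} (p : Quiver.Path i j) :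
    I.ringCon.mkₐ k (ofPath k ⟨i, j, p⟩) = (boundRep I).eval p := by
  induction p with
  | nil => rfl
  | @cons j l p b ih =>
    rw [PathRep.eval, ← ih, show (boundRep I).arrow b = arrowElt I b from rfl, arrowElt, ← map_mul,
      ofPath_mul_ofPath, pathMul_mk, Quiver.Path.comp_toPath_eq_cons]

variable {I} in
theorem boundQuiverAlgebra_linearMap_ext {N : Type*} [AddCommMonoid N] [Module k N]
    {f g : BoundQuiverAlgebra I →ₗ[k] N}
    (h : ∀ {i j : V} (p : Quiver.Path i j), f ((boundRep I).eval p) = g ((boundRep I).eval p)) :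
    f = g := by
  refine LinearMap.ext fun x => ?_
  obtain ⟨x, rfl⟩ := RingCon.mkₐ_surjective I.ringCon (α := k) x
  refine LinearMap.congr_fun (f := f ∘ₗ (I.ringCon.mkₐ k).toLinearMap)
    (g := g ∘ₗ (I.ringCon.mkₐ k).toLinearMap) (PathAlgebra.linearMap_ext ?_) x
  rintro ⟨i, j, p⟩
  simp only [LinearMap.comp_apply, AlgHom.toLinearMap_apply, mk_ofPath, h]

end

variable {M : Set (QPath V)}

theorem arrowElt_mul_arrowElt_of_mem {i j l : V} {a : i ⟶ j} {b : j ⟶ l} (h : twoPath a b ∈ M) :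
    arrowElt (pathIdeal k M) b * arrowElt (pathIdeal k M) a = 0 := by
  rw [arrowElt, arrowElt, ← map_mul, ofPath_mul_ofPath, pathMul_mk,
    Quiver.Path.comp_toPath_eq_cons]
  exact (TwoSidedIdeal.mem_ker _).1 <| (TwoSidedIdeal.ker_ringCon_mk' _).ge <|
    TwoSidedIdeal.subset_span (Set.mem_image_of_mem _ h)

namespace PathRep

variable {A : Type*} [Ring A] [Algebra k A]

/-- The algebra homomorphism out of a quadratic monomial algebra given by a representation of the
quiver which satisfies the relations. -/
def liftBound (ρ : PathRep V A) (hM : ∀ p ∈ M, p.2.2.length = 2)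
    (h : ∀ {i j l : V} (a : i ⟶ j) (b : j ⟶ l), twoPath a b ∈ M → ρ.arrow b * ρ.arrow a = 0) :
    BoundQuiverAlgebra (pathIdeal k M) →ₐ[k] A :=
  (pathIdeal k M).ringCon.liftₐ ρ.lift <| by
    have hle : pathIdeal k M ≤ TwoSidedIdeal.ker ρ.lift := TwoSidedIdeal.span_le.2 <| by
      rintro _ ⟨p, hp, rfl⟩
      obtain ⟨i, j, l, a, b, rfl⟩ := exists_eq_twoPath (hM p hp)
      rw [SetLike.mem_coe, TwoSidedIdeal.mem_ker, lift_ofPath]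
      change ρ.arrow b * (ρ.arrow a * ρ.vertex i) = 0
      rw [arrow_mul_vertex, h a b hp]
    exact TwoSidedIdeal.ringCon_le_iff.1 hle

variable (ρ : PathRep V A) (hM : ∀ p ∈ M, p.2.2.length = 2)
    (h : ∀ {i j l : V} (a : i ⟶ j) (b : j ⟶ l), twoPath a b ∈ M → ρ.arrow b * ρ.arrow a = 0)

theorem liftBound_vertexElt (i : V) :
    ρ.liftBound hM h (vertexElt (pathIdeal k M) i) = ρ.vertex i :=
  ρ.lift_ofPath ⟨i, i, .nil⟩

theorem liftBound_arrowElt {i j : V} (b : i ⟶ j) :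
    ρ.liftBound hM h (arrowElt (pathIdeal k M) b) = ρ.arrow b :=
  (ρ.lift_ofPath ⟨i, j, b.toPath⟩).trans (ρ.arrow_mul_vertex b)

end PathRep

theorem boundQuiverAlgebra_algHom_ext {I : TwoSidedIdeal (PathAlgebra k V)} {A : Type*} [Ring A]
    [Algebra k A] {f g : BoundQuiverAlgebra I →ₐ[k] A}
    (hv : ∀ i, f (vertexElt I i) = g (vertexElt I i))
    (ha : ∀ {i j : V} (b : i ⟶ j), f (arrowElt I b) = g (arrowElt I b)) : f = g := by
  refine AlgHom.toLinearMap_injective (boundQuiverAlgebra_linearMap_ext fun p => ?_)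
  induction p with
  | nil => exact hv _
  | cons p b ih =>
    change f (arrowElt I b * _) = g (arrowElt I b * _)
    rw [map_mul, map_mul, ha]
    exact congrArg _ ih

end BoundQuiver

/-! ### Derivations of quadratic monomial algebras -/

section Derivation

open scoped TensorProduct

variable {k : Type u} [Field k] {V : Type} [Quiver.{0} V] [Fintype V] {M : Set (QPath V)}
  {N : Type*} [AddCommGroup N] [Module k N]

section Bimodule

variable [Module (BoundQuiverAlgebra (pathIdeal k M)) N]
  [Module (BoundQuiverAlgebra (pathIdeal k M))ᵐᵒᵖ N]
  [SMulCommClass (BoundQuiverAlgebra (pathIdeal k M)) (BoundQuiverAlgebra (pathIdeal k M))ᵐᵒᵖ N]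
  [IsScalarTower k (BoundQuiverAlgebra (pathIdeal k M)) N]
  [IsScalarTower k (BoundQuiverAlgebra (pathIdeal k M))ᵐᵒᵖ N]

/-- A derivation is a homomorphism to the trivial extension that splits the projection. -/
theorem exists_leibniz_of_arrows (hM : ∀ p ∈ M, p.2.2.length = 2)
    (δ : ∀ {i j : V}, (i ⟶ j) → N)
    (hl : ∀ {i j : V} (b : i ⟶ j), vertexElt (pathIdeal k M) j • δ b = δ b)
    (hr : ∀ {i j : V} (b : i ⟶ j), MulOpposite.op (vertexElt (pathIdeal k M) i) • δ b = δ b)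
    (hδ : ∀ {i j l : V} (a : i ⟶ j) (b : j ⟶ l), twoPath a b ∈ M →
      arrowElt (pathIdeal k M) b • δ a + MulOpposite.op (arrowElt (pathIdeal k M) a) • δ b = 0) :
    ∃ D : BoundQuiverAlgebra (pathIdeal k M) →ₗ[k] N,
      (∀ x y, D (x * y) = x • D y + MulOpposite.op y • D x) ∧
      ∀ {i j : V} (b : i ⟶ j), D (arrowElt _ b) = δ b := by
  set Λ := BoundQuiverAlgebra (pathIdeal k M)
  let ρ : PathRep V (TrivSqZeroExt Λ N) :=
    { vertex i := .inl (vertexElt _ i)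
      complete := (completeOrthogonalIdempotents_vertexElt _).map (TrivSqZeroExt.inlHom Λ N)
      arrow b := .inl (arrowElt _ b) + .inr (δ b)
      vertex_mul_arrow b := by
        rw [mul_add, TrivSqZeroExt.inl_mul_inl, TrivSqZeroExt.inl_mul_inr, vertexElt_mul_arrowElt,
          hl]
      arrow_mul_vertex b := by
        rw [add_mul, TrivSqZeroExt.inl_mul_inl, TrivSqZeroExt.inr_mul_inl, arrowElt_mul_vertexElt,
          hr] }
  have hρ {i j l : V} (a : i ⟶ j) (b : j ⟶ l) (h : twoPath a b ∈ M) :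
      ρ.arrow b * ρ.arrow a = 0 := by
    ext
    · simp [ρ, arrowElt_mul_arrowElt_of_mem h]
    · simpa [ρ] using hδ a b h
  let φ : Λ →ₐ[k] TrivSqZeroExt Λ N := ρ.liftBound hM hρ
  have hφ : (TrivSqZeroExt.fstHom k Λ N).comp φ = AlgHom.id k Λ :=
    boundQuiverAlgebra_algHom_ext
      (fun i => congrArg TrivSqZeroExt.fst (ρ.liftBound_vertexElt hM hρ i))
      (fun b => (congrArg TrivSqZeroExt.fst (ρ.liftBound_arrowElt hM hρ b)).trans (add_zero _))
  have fst_φ (x : Λ) : (φ x).fst = x := AlgHom.congr_fun hφ x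
  refine ⟨TrivSqZeroExt.sndHom Λ N ∘ₗ φ.toLinearMap, fun x y => ?_, fun b => ?_⟩
  · change (φ (x * y)).snd = x • (φ y).snd + MulOpposite.op y • (φ x).snd
    rw [map_mul, TrivSqZeroExt.snd_mul, fst_φ, fst_φ]
  · exact (congrArg TrivSqZeroExt.snd (ρ.liftBound_arrowElt hM hρ b)).trans (zero_add _)

theorem exists_leibniz_of_arrow (hM : ∀ p ∈ M, p.2.2.length = 2) {i j : V} (a : i ⟶ j) {n : N}
    (hl : vertexElt (pathIdeal k M) j • n = n)
    (hr : MulOpposite.op (vertexElt (pathIdeal k M) i) • n = n)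
    (hb : ∀ {l : V} (b : j ⟶ l), twoPath a b ∈ M → arrowElt (pathIdeal k M) b • n = 0)
    (hc : ∀ {l : V} (c : l ⟶ i), twoPath c a ∈ M →
      MulOpposite.op (arrowElt (pathIdeal k M) c) • n = 0) :
    ∃ D : BoundQuiverAlgebra (pathIdeal k M) →ₗ[k] N,
      (∀ x y, D (x * y) = x • D y + MulOpposite.op y • D x) ∧
      D (arrowElt _ a) = n ∧ ∀ {p q : V} (b : p ⟶ q), (⟨p, q, b⟩ : Quiver.Total V) ≠ ⟨i, j, a⟩ →
        D (arrowElt _ b) = 0 := by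
  classical
  let δ {p q : V} (b : p ⟶ q) : N := if (⟨p, q, b⟩ : Quiver.Total V) = ⟨i, j, a⟩ then n else 0
  have hδ {P : ∀ {p q : V}, (p ⟶ q) → N → Prop} (ha : P a n)
      (h0 : ∀ {p q : V} (b : p ⟶ q), P b 0) {p q : V} (b : p ⟶ q) : P b (δ b) := by
    by_cases h : (⟨p, q, b⟩ : Quiver.Total V) = ⟨i, j, a⟩
    · cases h
      simpa only [δ, if_true] using ha
    · simpa only [δ, if_neg h] using h0 b
  obtain ⟨D, hD, hDa⟩ := exists_leibniz_of_arrows hM δ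
    (hδ (P := fun {_ q} _ x => vertexElt (pathIdeal k M) q • x = x) hl fun _ => smul_zero _)
    (hδ (P := fun {p _} _ x => MulOpposite.op (vertexElt (pathIdeal k M) p) • x = x) hr
      fun _ => smul_zero _)
    (fun c b h => by
      have hbc : arrowElt (pathIdeal k M) b • δ c = 0 :=
        hδ (P := fun {p q} c x => ∀ {l : V} (b : q ⟶ l), twoPath c b ∈ M →
          arrowElt (pathIdeal k M) b • x = 0) hb (fun _ _ _ _ => smul_zero _) c b h
      have hcb : MulOpposite.op (arrowElt (pathIdeal k M) c) • δ b = 0 :=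
        hδ (P := fun {p q} b x => ∀ {l : V} (c : l ⟶ p), twoPath c b ∈ M →
          MulOpposite.op (arrowElt (pathIdeal k M) c) • x = 0) hc (fun _ _ _ _ => smul_zero _) b c h
      rw [hbc, hcb, add_zero])
  exact ⟨D, hD, (hDa a).trans (if_pos rfl), fun b h => (hDa b).trans (if_neg h)⟩

end Bimodule

/-- `D` is a derivation with values in the `Λ`-`Λ`-bimodule `N`, which is encoded as a module over
the enveloping algebra. -/
def IsDerivation {Λ : Type u} [Ring Λ] [Algebra k Λ] [Module (Env k Λ) N] (D : Λ →ₗ[k] N) : Prop :=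
  ∀ x y, D (x * y) = (x ⊗ₜ 1 : Env k Λ) • D y + (1 ⊗ₜ MulOpposite.op y : Env k Λ) • D x

theorem exists_isDerivation_of_arrow [Module (Env k (BoundQuiverAlgebra (pathIdeal k M))) N]
    [IsScalarTower k (Env k (BoundQuiverAlgebra (pathIdeal k M))) N]
    (hM : ∀ p ∈ M, p.2.2.length = 2) {i j : V} (a : i ⟶ j) {n : N}
    (hl : (vertexElt (pathIdeal k M) j ⊗ₜ[k] (1 : (BoundQuiverAlgebra (pathIdeal k M))ᵐᵒᵖ)) • n = n)
    (hr : ((1 : BoundQuiverAlgebra (pathIdeal k M)) ⊗ₜ[k]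
      MulOpposite.op (vertexElt (pathIdeal k M) i)) • n = n)
    (hb : ∀ {l : V} (b : j ⟶ l), twoPath a b ∈ M →
      (arrowElt (pathIdeal k M) b ⊗ₜ[k] (1 : (BoundQuiverAlgebra (pathIdeal k M))ᵐᵒᵖ)) • n = 0)
    (hc : ∀ {l : V} (c : l ⟶ i), twoPath c a ∈ M →
      ((1 : BoundQuiverAlgebra (pathIdeal k M)) ⊗ₜ[k]
        MulOpposite.op (arrowElt (pathIdeal k M) c)) • n = 0) :
    ∃ D : BoundQuiverAlgebra (pathIdeal k M) →ₗ[k] N, IsDerivation D ∧ D (arrowElt _ a) = n ∧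
      ∀ {p q : V} (b : p ⟶ q), (⟨p, q, b⟩ : Quiver.Total V) ≠ ⟨i, j, a⟩ →
        D (arrowElt _ b) = 0 := by
  set Λ := BoundQuiverAlgebra (pathIdeal k M)
  let : Module Λ N :=
    Module.compHom N (Algebra.TensorProduct.includeLeftRingHom : Λ →+* Env k Λ)
  let : Module Λᵐᵒᵖ N :=
    Module.compHom N (Algebra.TensorProduct.includeRight : Λᵐᵒᵖ →ₐ[k] Env k Λ).toRingHom
  have smul_eq (x : Λ) (n : N) : x • n = (x ⊗ₜ 1 : Env k Λ) • n := rfl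
  have op_smul_eq (x : Λᵐᵒᵖ) (n : N) : x • n = (1 ⊗ₜ x : Env k Λ) • n := rfl
  have : SMulCommClass Λ Λᵐᵒᵖ N := ⟨fun x y n => by
    simp only [smul_eq, op_smul_eq, smul_smul, Algebra.TensorProduct.tmul_mul_tmul, one_mul,
      mul_one]⟩
  have : IsScalarTower k Λ N := ⟨fun c x n => by
    rw [smul_eq, smul_eq, ← TensorProduct.smul_tmul', smul_assoc]⟩
  have : IsScalarTower k Λᵐᵒᵖ N := ⟨fun c x n => by
    rw [op_smul_eq, op_smul_eq, TensorProduct.tmul_smul, smul_assoc]⟩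
  exact exists_leibniz_of_arrow hM a hl hr hb hc

end Derivation

/-! ### Coefficients -/

section Coeff

variable {k : Type u} [Field k] {V : Type} [Quiver.{0} V] [Fintype V] {M : Set (QPath V)}

variable (k) in
open Classical in
/-- The simple module at `i`, as a representation of the quiver in `k`. -/
def simpleRep (i : V) : PathRep V k where
  vertex v := (Pi.single v 1 : V → k) i
  complete := (CompleteOrthogonalIdempotents.single fun _ : V => k).map
    (Pi.evalRingHom (fun _ : V => k) i)
  arrow _ := 0
  vertex_mul_arrow _ := mul_zero _
  arrow_mul_vertex _ := zero_mul _

theorem simpleRep_arrow_mul_arrow (v : V) {i j l : V} (a : i ⟶ j) (b : j ⟶ l) :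
    (simpleRep k v).arrow b * (simpleRep k v).arrow a = 0 :=
  mul_zero _

/-- The coefficient of the idempotent at `i`; it is the character of the simple module at `i`. -/
def vertexCoeff (hM : ∀ p ∈ M, p.2.2.length = 2) (i : V) :
    BoundQuiverAlgebra (pathIdeal k M) →ₐ[k] k :=
  (simpleRep k i).liftBound hM fun a b _ => simpleRep_arrow_mul_arrow i a b

variable (hM : ∀ p ∈ M, p.2.2.length = 2)

open Classical in
theorem vertexCoeff_vertexElt_self (i : V) :
    vertexCoeff hM i (vertexElt (pathIdeal k M) i) = 1 :=
  ((simpleRep k i).liftBound_vertexElt hM (fun a b _ => simpleRep_arrow_mul_arrow i a b) i).trans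
    (Pi.single_eq_same i 1)

theorem vertexCoeff_arrowElt (l : V) {i j : V} (b : i ⟶ j) :
    vertexCoeff hM l (arrowElt (pathIdeal k M) b) = 0 :=
  (simpleRep k l).liftBound_arrowElt hM (fun a b _ => simpleRep_arrow_mul_arrow l a b) b

theorem exists_arrowCoeff {i j : V} (a : i ⟶ j) :
    ∃ c : BoundQuiverAlgebra (pathIdeal k M) →ₗ[k] k,
      (∀ x y, c (x * y) = vertexCoeff hM j x * c y + c x * vertexCoeff hM i y) ∧
      c (arrowElt _ a) = 1 := by
  set Λ := BoundQuiverAlgebra (pathIdeal k M)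
  let : Module Λ k := Module.compHom k (vertexCoeff hM j).toRingHom
  let : Module Λᵐᵒᵖ k := Module.compHom k
    ((vertexCoeff hM i).toRingHom.fromOpposite fun _ _ => .all _ _)
  have smul_eq (x : Λ) (c : k) : x • c = vertexCoeff hM j x * c := rfl
  have op_smul_eq (x : Λ) (c : k) : MulOpposite.op x • c = vertexCoeff hM i x * c := rfl
  have : SMulCommClass Λ Λᵐᵒᵖ k := ⟨fun _ _ _ => mul_left_comm _ _ _⟩
  have : IsScalarTower k Λ k := ⟨fun c x d => by
    rw [smul_eq, smul_eq, map_smul, smul_mul_assoc]⟩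
  have : IsScalarTower k Λᵐᵒᵖ k := ⟨fun c x d => by
    change vertexCoeff hM i (c • x.unop) * d = c * (vertexCoeff hM i x.unop * d)
    rw [map_smul, smul_mul_assoc, smul_eq_mul]⟩
  obtain ⟨c, hc, ha, -⟩ := exists_leibniz_of_arrow hM a (n := (1 : k))
    (by rw [smul_eq, vertexCoeff_vertexElt_self, one_mul])
    (by rw [op_smul_eq, vertexCoeff_vertexElt_self, one_mul])
    (fun b _ => by rw [smul_eq, vertexCoeff_arrowElt, zero_mul])
    (fun c _ => by rw [op_smul_eq, vertexCoeff_arrowElt, zero_mul])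
  exact ⟨c, fun x y => by rw [hc, smul_eq, op_smul_eq, mul_comm (c x)], ha⟩

/-- A form which serves as the coefficient of the arrow `a`: it takes the value `1` at `a` and is a
derivation with respect to the characters at the end points of `a`. -/
def arrowCoeff {i j : V} (a : i ⟶ j) : BoundQuiverAlgebra (pathIdeal k M) →ₗ[k] k :=
  (exists_arrowCoeff hM a).choose

theorem arrowCoeff_mul {i j : V} (a : i ⟶ j) (x y : BoundQuiverAlgebra (pathIdeal k M)) :
    arrowCoeff hM a (x * y) =
      vertexCoeff hM j x * arrowCoeff hM a y + arrowCoeff hM a x * vertexCoeff hM i y :=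
  (exists_arrowCoeff hM a).choose_spec.1 x y

theorem arrowCoeff_arrowElt_self {i j : V} (a : i ⟶ j) :
    arrowCoeff hM a (arrowElt (pathIdeal k M) a) = 1 :=
  (exists_arrowCoeff hM a).choose_spec.2

theorem arrowCoeff_arrowElt_mul {i j : V} (b : i ⟶ j) (x : BoundQuiverAlgebra (pathIdeal k M)) :
    arrowCoeff hM b (arrowElt _ b * x) = vertexCoeff hM i x := by
  rw [arrowCoeff_mul, vertexCoeff_arrowElt, arrowCoeff_arrowElt_self, zero_mul, zero_add, one_mul]

theorem arrowCoeff_mul_arrowElt {i j : V} (b : i ⟶ j) (x : BoundQuiverAlgebra (pathIdeal k M)) :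
    arrowCoeff hM b (x * arrowElt _ b) = vertexCoeff hM j x := by
  rw [arrowCoeff_mul, vertexCoeff_arrowElt, arrowCoeff_arrowElt_self, mul_zero, add_zero, mul_one]

end Coeff

/-! ### Derivations with values in spaces of homomorphisms -/

section HomDerivation

/-- A derivation of `R` with values in the bimodule of additive maps from `N` to `L`. It is a
cocycle for an extension of `N` by `L`. -/
structure HomDerivation (R N L : Type*) [Ring R] [AddCommGroup N] [Module R N] [AddCommGroup L]
    [Module R L] where
  /-- The underlying biadditive map. -/
  toAddHom : R →+ N →+ L
  map_mul : ∀ x y n, toAddHom (x * y) n = x • toAddHom y n + toAddHom x (y • n)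

namespace HomDerivation

variable {R N L : Type*} [Ring R] [AddCommGroup N] [Module R N] [AddCommGroup L] [Module R L]
  (c : HomDerivation R N L)

theorem map_one (n : N) : c.toAddHom 1 n = 0 := by
  simpa only [one_mul, one_smul, left_eq_add] using c.map_mul 1 1 n

/-- `c` is the commutator with an additive map from `N` to `L`. -/
def IsInner : Prop :=
  ∃ h : N →+ L, ∀ x n, c.toAddHom x n = x • h n - h (x • n)

/-- The extension of `N` by `L` with cocycle `c`: the group `L × N` with the action
`x (l, n) = (x l + c x n, x n)`. -/
def Extension (_ : HomDerivation R N L) : Type _ := L × N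

instance : AddCommGroup c.Extension := inferInstanceAs (AddCommGroup (L × N))

instance : Module R c.Extension where
  smul x p := (x • p.1 + c.toAddHom x p.2, x • p.2)
  one_smul p := Prod.ext
    (show (1 : R) • p.1 + c.toAddHom 1 p.2 = p.1 by rw [c.map_one, one_smul, add_zero])
    (one_smul R p.2)
  mul_smul x y p := Prod.ext
    (show (x * y) • p.1 + c.toAddHom (x * y) p.2 =
        x • (y • p.1 + c.toAddHom y p.2) + c.toAddHom x (y • p.2) by
      rw [c.map_mul, smul_add, mul_smul, add_assoc])
    (mul_smul x y p.2)
  smul_zero x := Prod.ext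
    (show x • (0 : L) + c.toAddHom x 0 = 0 by rw [map_zero, smul_zero, add_zero])
    (smul_zero x)
  smul_add x p q := Prod.ext
    (show x • (p.1 + q.1) + c.toAddHom x (p.2 + q.2) =
        x • p.1 + c.toAddHom x p.2 + (x • q.1 + c.toAddHom x q.2) by
      rw [map_add, smul_add, add_add_add_comm])
    (smul_add x p.2 q.2)
  add_smul x y p := Prod.ext
    (show (x + y) • p.1 + c.toAddHom (x + y) p.2 =
        x • p.1 + c.toAddHom x p.2 + (y • p.1 + c.toAddHom y p.2) by
      rw [map_add, AddMonoidHom.add_apply, add_smul, add_add_add_comm])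
    (add_smul x y p.2)
  zero_smul p := Prod.ext
    (show (0 : R) • p.1 + c.toAddHom 0 p.2 = 0 by
      rw [map_zero, AddMonoidHom.zero_apply, zero_smul, add_zero])
    (zero_smul R p.2)

/-- The inclusion of `L` into an extension of `N` by `L`. -/
def Extension.inl : L →ₗ[R] c.Extension where
  toFun l := (l, 0)
  map_add' l l' := Prod.ext rfl (add_zero (0 : N)).symm
  map_smul' x l := Prod.ext
    (show x • l = x • l + c.toAddHom x 0 by rw [map_zero, add_zero]) (smul_zero x).symm

/-- The projection of an extension of `N` by `L` to `N`. -/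
def Extension.snd : c.Extension →ₗ[R] N where
  toFun p := p.2
  map_add' _ _ := rfl
  map_smul' _ _ := rfl

theorem isInner_of_retraction (r : c.Extension →ₗ[R] L)
    (hr : ∀ l, r (Extension.inl c l) = l) : c.IsInner := by
  let s : N →+ c.Extension := AddMonoidHom.inr L N
  refine ⟨r.toAddMonoidHom.comp s, fun x n => ?_⟩
  have hs : x • s n = Extension.inl c (c.toAddHom x n) + s (x • n) := Prod.ext
    (show x • (0 : L) + c.toAddHom x n = c.toAddHom x n + 0 by
      rw [smul_zero, zero_add, add_zero]) (zero_add (x • n)).symm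
  change c.toAddHom x n = x • r (s n) - r (s (x • n))
  rw [← map_smul, hs, map_add, hr, add_sub_cancel_right]

end HomDerivation

end HomDerivation

section Contraction

open scoped TensorProduct

variable {k : Type u} [Field k] {Λ : Type u} [Ring Λ] [Algebra k Λ]

/-- The contraction `x ⊗ y ↦ φ y • x` of the second tensor factor with a linear form. -/
def contract (φ : DualBimodule k Λ) : Env k Λ →ₗ[k] Λ :=
  TensorProduct.lift ((LinearMap.lsmul k Λ).flip.compl₂
    (LinearMap.comp (M₂ := Λ) φ (MulOpposite.opLinearEquiv k).symm.toLinearMap))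

theorem contract_tmul (φ : DualBimodule k Λ) (x y : Λ) :
    contract φ (x ⊗ₜ MulOpposite.op y) = φ y • x := rfl

theorem contract_add (φ ψ : DualBimodule k Λ) (z : Env k Λ) :
    contract (φ + ψ) z = contract φ z + contract ψ z := by
  refine LinearMap.congr_fun (g := contract φ + contract ψ) (TensorProduct.ext' fun x y => ?_) z
  exact add_smul (φ y.unop) (ψ y.unop) x

theorem contract_tmul_one_mul (φ : DualBimodule k Λ) (x : Λ) (z : Env k Λ) :
    contract φ ((x ⊗ₜ 1) * z) = x * contract φ z := by
  refine LinearMap.congr_fun (f := contract φ ∘ₗ LinearMap.mulLeft k (x ⊗ₜ 1 : Env k Λ))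
    (g := LinearMap.mulLeft k x ∘ₗ contract φ) (TensorProduct.ext' fun u v => ?_) z
  simp only [LinearMap.comp_apply, LinearMap.mulLeft_apply, Algebra.TensorProduct.tmul_mul_tmul,
    one_mul]
  exact (mul_smul_comm (φ v.unop) x u).symm

theorem contract_one_tmul_mul (φ : DualBimodule k Λ) (y : Λ) (z : Env k Λ) :
    contract φ ((1 ⊗ₜ MulOpposite.op y) * z) = contract (y • φ) z := by
  refine LinearMap.congr_fun
    (f := contract φ ∘ₗ LinearMap.mulLeft k (1 ⊗ₜ MulOpposite.op y : Env k Λ))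
    (g := contract (y • φ)) (TensorProduct.ext' fun u v => ?_) z
  simp only [LinearMap.comp_apply, LinearMap.mulLeft_apply, Algebra.TensorProduct.tmul_mul_tmul,
    one_mul]
  rfl

/-- The contractions of the values of a derivation with the linear forms on `Λ`. -/
def contractDerivation (D : Λ →ₗ[k] Env k Λ) (hD : IsDerivation D) :
    HomDerivation Λ (DualBimodule k Λ) Λ where
  toAddHom := AddMonoidHom.flip <| AddMonoidHom.mk'
    (fun φ => (contract φ).toAddMonoidHom.comp D.toAddMonoidHom)
    fun φ ψ => AddMonoidHom.ext fun x => contract_add φ ψ (D x)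
  map_mul x y φ := by
    change contract φ (D (x * y)) = x * contract φ (D y) + contract (y • φ) (D x)
    rw [hD, map_add, smul_eq_mul, smul_eq_mul, contract_tmul_one_mul, contract_one_tmul_mul]

theorem contractDerivation_apply (D : Λ →ₗ[k] Env k Λ) (hD : IsDerivation D) (x : Λ)
    (φ : DualBimodule k Λ) : (contractDerivation D hD).toAddHom x φ = contract φ (D x) := rfl

variable (k Λ) in
/-- All contractions of derivations `Λ → Λ ⊗ Λ` are inner. This is the common consequence of the
two cohomological conditions of the main theorem from which the shape of the quiver is read off. -/
def ContractionsInner : Prop :=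
  ∀ (D : Λ →ₗ[k] Env k Λ) (hD : IsDerivation D), (contractDerivation D hD).IsInner

end Contraction

section ExtVanishing

open scoped TensorProduct

variable {k : Type u} [Field k] {Λ : Type u} [Ring Λ] [Algebra k Λ]

variable (k Λ) in
/-- The multiplication `Λ ⊗ Λ → Λ`, as a map of bimodules. -/
def envAugmentation : Env k Λ →ₗ[Env k Λ] regularBimodule k Λ :=
  LinearMap.toSpanSingleton (Env k Λ) (regularBimodule k Λ) (1 : Λ)

theorem envAugmentation_tmul (x y : Λ) :
    envAugmentation k Λ (x ⊗ₜ MulOpposite.op y) = (x * y : Λ) := by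
  let : Module (Env k Λ) Λ := TensorProduct.Algebra.module
  refine (TensorProduct.Algebra.smul_def x (MulOpposite.op y) (1 : Λ)).trans ?_
  exact congrArg (x * ·) (one_mul y)

theorem envAugmentation_surjective : Function.Surjective (envAugmentation k Λ) := fun x =>
  ⟨(x : Λ) ⊗ₜ MulOpposite.op 1, (envAugmentation_tmul _ _).trans (mul_one (show Λ from x))⟩

section DerivationLift

variable {N : Type*} [AddCommGroup N] [Module k N] [Module (Env k Λ) N]

theorem IsDerivation.map_one {D : Λ →ₗ[k] N} (hD : IsDerivation D) : D 1 = 0 := by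
  have h := hD 1 1
  rwa [MulOpposite.op_one, ← Algebra.TensorProduct.one_def, one_mul, one_smul, left_eq_add] at h

variable [IsScalarTower k (Env k Λ) N]

/-- The map `x ⊗ y ↦ D x y`. -/
def derivationLift (D : Λ →ₗ[k] N) : Env k Λ →ₗ[k] N :=
  TensorProduct.lift <| LinearMap.flip <| LinearMap.compl₂ (((Algebra.lsmul k k N).toLinearMap) ∘ₗ
    (Algebra.TensorProduct.includeRight : Λᵐᵒᵖ →ₐ[k] Env k Λ).toLinearMap) D

theorem derivationLift_tmul (D : Λ →ₗ[k] N) (x : Λ) (y : Λᵐᵒᵖ) :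
    derivationLift D (x ⊗ₜ y) = (1 ⊗ₜ y : Env k Λ) • D x := rfl

theorem IsDerivation.derivationLift_tmul_mul {D : Λ →ₗ[k] N} (hD : IsDerivation D) (x : Λ)
    (y : Λᵐᵒᵖ) (z : Env k Λ) :
    derivationLift D ((x ⊗ₜ y) * z) = (x ⊗ₜ y : Env k Λ) • derivationLift D z +
      (1 ⊗ₜ (y * MulOpposite.op (show Λ from envAugmentation k Λ z)) : Env k Λ) • D x := by
  induction z using TensorProduct.induction_on with
  | zero =>
    rw [mul_zero, map_zero, smul_zero, map_zero, zero_add]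
    change 0 = (1 ⊗ₜ (y * MulOpposite.op (0 : Λ)) : Env k Λ) • D x
    rw [MulOpposite.op_zero, mul_zero, TensorProduct.tmul_zero]
    exact (zero_smul (Env k Λ) (D x)).symm
  | add z z' hz hz' =>
    have hadd : MulOpposite.op (show Λ from envAugmentation k Λ (z + z')) =
        MulOpposite.op (show Λ from envAugmentation k Λ z) +
          MulOpposite.op (show Λ from envAugmentation k Λ z') :=
      congrArg MulOpposite.op (map_add (envAugmentation k Λ) z z')
    rw [mul_add, map_add, hz, hz', hadd, map_add, smul_add, mul_add, TensorProduct.tmul_add,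
      add_smul, add_add_add_comm]
  | tmul u v =>
    have huv : MulOpposite.op (show Λ from envAugmentation k Λ (u ⊗ₜ v)) =
        v * MulOpposite.op u := congrArg MulOpposite.op (envAugmentation_tmul u v.unop)
    rw [Algebra.TensorProduct.tmul_mul_tmul, derivationLift_tmul, derivationLift_tmul, huv, hD,
      smul_add, smul_smul, smul_smul, smul_smul]
    simp only [Algebra.TensorProduct.tmul_mul_tmul, one_mul, mul_one, mul_assoc]

/-- On the kernel of the multiplication the lift of a derivation is a map of bimodules. -/
def IsDerivation.kerLift {D : Λ →ₗ[k] N} (hD : IsDerivation D) :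
    LinearMap.ker (envAugmentation k Λ) →ₗ[Env k Λ] N where
  toFun z := derivationLift D z
  map_add' _ _ := map_add _ _ _
  map_smul' c z := by
    obtain ⟨z, hz⟩ := z
    change derivationLift D (c * z) = c • derivationLift D z
    induction c using TensorProduct.induction_on with
    | zero =>
      rw [zero_mul, map_zero]
      exact (zero_smul (Env k Λ) (derivationLift D z)).symm
    | add c c' hc hc' => rw [add_mul, map_add, hc, hc', add_smul]
    | tmul x y =>
      have hop : MulOpposite.op (show Λ from envAugmentation k Λ z) = 0 :=
        congrArg MulOpposite.op hz
      rw [hD.derivationLift_tmul_mul, hop, mul_zero, TensorProduct.tmul_zero, add_eq_left]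
      exact zero_smul (Env k Λ) (D x)

end DerivationLift

/-- A derivation `D` defines the bimodule map `x ⊗ y ↦ D x y` on the kernel of `Λ ⊗ Λ → Λ`; it is
inner because this map extends to `Λ ⊗ Λ`. -/
theorem IsDerivation.exists_eq_sub_of_subsingleton_ext {N : Type u} [AddCommGroup N] [Module k N]
    [Module (Env k Λ) N] [IsScalarTower k (Env k Λ) N]
    (h : Subsingleton (Abelian.Ext (regularBimodule k Λ) (ModuleCat.of (Env k Λ) N) 1))
    {D : Λ →ₗ[k] N} (hD : IsDerivation D) :
    ∃ n : N, ∀ x, D x = (x ⊗ₜ 1 : Env k Λ) • n - (1 ⊗ₜ MulOpposite.op x : Env k Λ) • n := by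
  have hS := LinearMap.shortExact_shortComplexKer (f := envAugmentation k Λ)
    envAugmentation_surjective
  obtain ⟨e, he⟩ := Abelian.Ext.contravariant_sequence_exact₁ hS (ModuleCat.of (Env k Λ) N)
    (Abelian.Ext.mk₀ (ModuleCat.ofHom hD.kerLift)) (n₁ := 1) rfl (h.elim _ _)
  obtain ⟨ψ, rfl⟩ := (Abelian.Ext.mk₀_bijective _ _).2 e
  rw [Abelian.Ext.mk₀_comp_mk₀] at he
  have hψ (z : LinearMap.ker (envAugmentation k Λ)) : ψ.hom (z : Env k Λ) = derivationLift D z :=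
    congrArg (fun f => f.hom z) ((Abelian.Ext.mk₀_bijective _ _).1 he)
  have hψ_one (z : Env k Λ) : ψ.hom z = z • ψ.hom (1 : Env k Λ) :=
    (congrArg ψ.hom (mul_one z).symm).trans (ψ.hom.map_smul z (1 : Env k Λ))
  refine ⟨ψ.hom (1 : Env k Λ), fun x => ?_⟩
  have hker : envAugmentation k Λ (x ⊗ₜ 1 - 1 ⊗ₜ MulOpposite.op x) = 0 := by
    rw [map_sub, sub_eq_zero]
    exact (envAugmentation_tmul x 1).trans
      ((mul_one x).trans ((one_mul x).symm.trans (envAugmentation_tmul 1 x).symm))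
  calc D x = derivationLift D (x ⊗ₜ 1 - 1 ⊗ₜ MulOpposite.op x) := by
        rw [map_sub, derivationLift_tmul, derivationLift_tmul, hD.map_one, smul_zero, sub_zero,
          ← Algebra.TensorProduct.one_def, one_smul]
    _ = (x ⊗ₜ 1 - 1 ⊗ₜ MulOpposite.op x : Env k Λ) • ψ.hom (1 : Env k Λ) :=
        (hψ ⟨_, hker⟩).symm.trans (hψ_one _)
    _ = _ := sub_smul _ _ _

theorem contractionsInner_of_subsingleton_ext (h : Subsingleton (ExtEnv k Λ 1)) :
    ContractionsInner k Λ := by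
  intro D hD
  obtain ⟨z, hz⟩ := hD.exists_eq_sub_of_subsingleton_ext h
  refine ⟨AddMonoidHom.mk' (fun φ => contract φ z) fun φ ψ => contract_add φ ψ z, fun x φ => ?_⟩
  rw [contractDerivation_apply, hz, map_sub, smul_eq_mul, smul_eq_mul, contract_tmul_one_mul,
    contract_one_tmul_mul]
  rfl

end ExtVanishing

/-! ### The inverse Serre functor -/

open HomologicalComplex in
/-- The projective object `S.X₁` maps to the cycles of the injective object `J.X i`, and this map
extends to `S.X₂`. The hypothesis on `S.X₃` allows the extension to be corrected by a map which
vanishes on `S.X₁` so that it takes values in the cycles again. -/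
theorem isSplitMono_of_homology_iso {C : Type*} [Category C] [Abelian C] {ι : Type*}
    {c : ComplexShape ι} {J : HomologicalComplex C c} {i j l : ι} (hij : c.next i = j)
    [Injective (J.X i)] {S : ShortComplex C} (hS : S.ShortExact) [Projective S.X₁]
    (e : J.homology i ≅ S.X₁)
    (hJ : ∀ f : S.X₃ ⟶ J.X j, f ≫ J.d j l = 0 → ∃ g : S.X₃ ⟶ J.X i, g ≫ J.d i j = f) :
    IsSplitMono S.f := by
  have := hS.mono_f
  have := hS.epi_g
  let s : S.X₁ ⟶ J.cycles i := Projective.factorThru e.inv (J.homologyπ i)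
  let t : S.X₂ ⟶ J.X i := Injective.factorThru (s ≫ J.iCycles i) S.f
  have ht : S.f ≫ t = s ≫ J.iCycles i := Injective.comp_factorThru _ _
  have htd : S.f ≫ t ≫ J.d i j = 0 := by
    rw [← Category.assoc, ht, Category.assoc, J.iCycles_d, Limits.comp_zero]
  obtain ⟨g, hg⟩ := hJ (hS.exact.desc (t ≫ J.d i j) htd) <| by
    rw [← cancel_epi S.g, ← Category.assoc, hS.exact.g_desc, Category.assoc, J.d_comp_d,
      Limits.comp_zero, Limits.comp_zero]
  have hcycle : (t - S.g ≫ g) ≫ J.d i j = 0 := by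
    rw [Preadditive.sub_comp, Category.assoc, hg, hS.exact.g_desc, sub_self]
  have hlift : S.f ≫ J.liftCycles (t - S.g ≫ g) j hij hcycle = s := by
    rw [← cancel_mono (J.iCycles i), Category.assoc, liftCycles_i, Preadditive.comp_sub, ht,
      S.zero_assoc, Limits.zero_comp, sub_zero]
  refine .mk' ⟨J.liftCycles (t - S.g ≫ g) j hij hcycle ≫ J.homologyπ i ≫ e.hom, ?_⟩
  rw [← Category.assoc, hlift, ← Category.assoc, Projective.factorThru_comp, Iso.inv_hom_id]

section HomFunctor

variable {Λ : Type u} [Ring Λ]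

theorem exists_comp_d_eq_of_isZero_homology {B : Type u} [AddCommGroup B] [Module Λ B]
    [Module Λᵐᵒᵖ B] [SMulCommClass Λ Λᵐᵒᵖ B] {ι : Type*} {c : ComplexShape ι}
    {J : HomologicalComplex (ModuleCat.{u} Λ) c} {i j l : ι} (hij : c.prev j = i)
    (hjl : c.next j = l)
    (hJ : Limits.IsZero ((((homFunctor (Λ := Λ) B).mapHomologicalComplex c).obj J).homology j))
    (f : ModuleCat.of Λ B ⟶ J.X j) (hf : f ≫ J.d j l = 0) :
    ∃ g : ModuleCat.of Λ B ⟶ J.X i, g ≫ J.d i j = f := by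
  rw [← HomologicalComplex.exactAt_iff_isZero_homology,
    HomologicalComplex.exactAt_iff' _ i j l hij hjl, ShortComplex.moduleCat_exact_iff] at hJ
  obtain ⟨g, hg⟩ := hJ (show BimodHom (Λ := Λ) B (J.X j) from f.hom)
    (congrArg ModuleCat.Hom.hom hf)
  exact ⟨ModuleCat.ofHom (show B →ₗ[Λ] J.X i from g), ModuleCat.hom_ext hg⟩

namespace HomDerivation

variable {N L : Type u} [AddCommGroup N] [Module Λ N] [AddCommGroup L] [Module Λ L]
  (c : HomDerivation Λ N L)

/-- The short exact sequence of an extension of `N` by `L`. -/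
def Extension.shortComplex : ShortComplex (ModuleCat.{u} Λ) :=
  .mk (ModuleCat.ofHom (Extension.inl c)) (ModuleCat.ofHom (Extension.snd c)) rfl

theorem Extension.shortExact : (Extension.shortComplex c).ShortExact :=
  ModuleCat.shortComplex_shortExact _
    (fun p => ⟨fun hp => ⟨p.1, Prod.ext rfl hp.symm⟩, fun ⟨_, hl⟩ => hl ▸ rfl⟩)
    (fun _ _ h => congrArg Prod.fst h) fun n => ⟨((0 : L), n), rfl⟩

theorem isInner_of_isSplitMono [IsSplitMono (Extension.shortComplex c).f] : c.IsInner :=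
  c.isInner_of_retraction (retraction (Extension.shortComplex c).f).hom fun l =>
    congrArg (fun f => f.hom l) (IsSplitMono.id (Extension.shortComplex c).f)

end HomDerivation

end HomFunctor

section Hereditary

attribute [local instance] HasDerivedCategory.standard

variable {k : Type u} [Field k] {Λ : Type u} [Ring Λ] [Algebra k Λ]

theorem IsNHereditary.exists_complex {n : ℕ} (hn : n ≠ 1) (h : IsNHereditary k Λ n) :
    ∃ J : CochainComplex (ModuleCat.{u} Λ) ℤ, Injective (J.X 0) ∧
      Nonempty (J.homology 0 ≅ ModuleCat.of Λ Λ) ∧ Limits.IsZero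
        ((((homFunctor (DualBimodule k Λ)).mapHomologicalComplex _).obj J).homology 1) := by
  obtain ⟨-, -, X, hX, hvan⟩ := h
  obtain ⟨J, hJ, ⟨eJ⟩, ⟨eHom⟩⟩ := hX.pred 0
  obtain ⟨e₀⟩ := hX.zero
  rw [Nat.cast_zero, neg_zero] at eJ
  rw [Nat.cast_zero, neg_zero, zero_sub] at eHom
  refine ⟨J, (hJ.1 0).1, ⟨?_⟩, ?_⟩
  · exact ((DerivedCategory.homologyFunctorFactors _ 0).app J).symm ≪≫
      (DerivedCategory.homologyFunctor _ 0).mapIso (eJ ≪≫ e₀) ≪≫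
      (DerivedCategory.singleFunctorCompHomologyFunctorIso _ 0).app _
  · have hdvd : ¬ (n : ℤ) ∣ 1 - n := by
      rwa [dvd_sub_self_right, ← Nat.cast_one, Int.natCast_dvd_natCast, Nat.dvd_one]
    have eShift := ((DerivedCategory.homologyFunctor (ModuleCat.{u} Λ) 0).shiftIso
      (-((n : ℤ) * (-1))) (1 - n) 1 (by ring)).app (X (-1))
    exact (((hvan (-1) (1 - n) hdvd).of_iso eShift.symm).of_iso
      ((DerivedCategory.homologyFunctor _ 1).mapIso eHom)).of_iso
      ((DerivedCategory.homologyFunctorFactors _ 1).app _).symm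

theorem contractionsInner_of_isNHereditary {n : ℕ} (hn : n ≠ 1) (h : IsNHereditary k Λ n) :
    ContractionsInner k Λ := by
  intro D hD
  obtain ⟨J, hJ, ⟨e⟩, hHom⟩ := h.exists_complex hn
  have : Projective (HomDerivation.Extension.shortComplex (contractDerivation D hD)).X₁ :=
    (IsProjective.iff_projective Λ).1 inferInstance
  have := isSplitMono_of_homology_iso (by simp)
    (HomDerivation.Extension.shortExact (contractDerivation D hD)) e
    (exists_comp_d_eq_of_isZero_homology (l := 2) (by simp) (by simp) hHom)
  exact HomDerivation.isInner_of_isSplitMono _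

end Hereditary

/-! ### Consequences of the global dimension -/

section GlobalDimension

variable {R : Type u} [Ring R]

theorem hasProjectiveDimensionLE_of_globalDimension_le {n : ℕ} (h : globalDimension R ≤ n)
    (M : ModuleCat.{u} R) : HasProjectiveDimensionLE M n :=
  (projectiveDimension_le_iff M n).1 <|
    (le_iSup (fun M : ModuleCat.{u} R => projectiveDimension M) M).trans h

theorem projective_ker_of_globalDimension_le_two (h : globalDimension R ≤ (2 : ℕ))
    {P Q : Type u} [AddCommGroup P] [Module R P] [AddCommGroup Q] [Module R Q]
    [Module.Projective R P] [Module.Projective R Q] (f : P →ₗ[R] Q) :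
    Module.Projective R (LinearMap.ker f) := by
  have projective_of (N : Type u) [AddCommGroup N] [Module R N] [Module.Projective R N] (n : ℕ) :
      HasProjectiveDimensionLT (ModuleCat.of R N) (n + 1) :=
    have : Projective (ModuleCat.of R N) := (IsProjective.iff_projective N).1 inferInstance
    inferInstance
  have hcoker := hasProjectiveDimensionLE_of_globalDimension_le h
    (ModuleCat.of R (Q ⧸ LinearMap.range f))
  have hrange : HasProjectiveDimensionLT (ModuleCat.of R (LinearMap.range f)) 2 := by
    rw [← (LinearMap.range f).ker_mkQ]
    exact (LinearMap.shortExact_shortComplexKer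
      (LinearMap.range f).mkQ_surjective).hasProjectiveDimensionLT_X₁ 2 (projective_of Q 1) hcoker
  rw [← LinearMap.ker_rangeRestrict]
  have hker : HasProjectiveDimensionLT
      (ModuleCat.of R (LinearMap.ker f.rangeRestrict)) 1 :=
    (LinearMap.shortExact_shortComplexKer
      f.surjective_rangeRestrict).hasProjectiveDimensionLT_X₁ 1 (projective_of P 0) hrange
  exact (IsProjective.iff_projective _).2 (projective_iff_hasProjectiveDimensionLT_one.2 hker)

theorem globalDimension_le_zero_of_isSemisimpleRing [IsSemisimpleRing R] :
    globalDimension R ≤ (0 : ℕ) :=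
  iSup_le fun M => (projectiveDimension_le_iff M 0).2 <|
    (projective_iff_hasProjectiveDimensionLE_zero M).1 <|
      (IsProjective.iff_projective M).1 (Module.projective_of_isSemisimpleRing _ _)

end GlobalDimension

theorem weaklyConnected_induction {V : Type*} [Quiver V]
    (hconn : Subsingleton (Quiver.WeaklyConnectedComponent V)) {P : V → Prop}
    (hP : ∀ {i j : V}, (i ⟶ j) → (P i ↔ P j)) {i : V} (hi : P i) (j : V) : P j := by
  obtain ⟨p⟩ := (Quiver.WeaklyConnectedComponent.eq i j).1 (Subsingleton.elim _ _)
  induction p with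
  | nil => exact hi
  | cons _ b ih => exact b.elim (fun b => (hP b).1 ih) fun b => (hP b).2 ih

section BoundQuiver

variable {k : Type u} [Field k] {V : Type} [Quiver.{0} V] [Fintype V]

theorem exists_arrow_of_globalDimension_pos
    (hconn : Subsingleton (Quiver.WeaklyConnectedComponent V)) {I : TwoSidedIdeal (PathAlgebra k V)}
    (h : 0 < globalDimension (BoundQuiverAlgebra I)) : ∃ i j : V, Nonempty (i ⟶ j) := by
  by_contra! hempty
  have : Subsingleton V := ⟨fun i =>
    weaklyConnected_induction hconn (fun b => ((hempty _ _).false b).elim) rfl⟩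
  let S : Submodule k (BoundQuiverAlgebra I) := LinearMap.range (Algebra.linearMap k _)
  have hS : S.mkQ = 0 := boundQuiverAlgebra_linearMap_ext fun {i j} p => by
    cases p with
    | cons p b => exact ((hempty _ _).false b).elim
    | nil =>
      have hone : vertexElt I i = 1 := by
        rw [← (completeOrthogonalIdempotents_vertexElt I).complete, Fintype.sum_subsingleton _ i]
      exact (Submodule.Quotient.mk_eq_zero S).2 ⟨1, (map_one (algebraMap k _)).trans hone.symm⟩
  have hsurj : Function.Surjective (algebraMap k (BoundQuiverAlgebra I)) := fun x =>
    (Submodule.Quotient.mk_eq_zero S).1 (LinearMap.congr_fun hS x)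
  have := RingHom.isSemisimpleRing_of_surjective _ hsurj
  exact h.not_ge globalDimension_le_zero_of_isSemisimpleRing

variable {M : Set (QPath V)} (hM : ∀ p ∈ M, p.2.2.length = 2)
include hM

theorem arrowElt_ne_sum {i j : V} (a : i ⟶ j) {ι : Type*} (s : Finset ι)
    (x y : ι → BoundQuiverAlgebra (pathIdeal k M)) (hx : ∀ t ∈ s, vertexCoeff hM j (x t) = 0)
    (hy : ∀ t ∈ s, vertexCoeff hM i (y t) = 0) : arrowElt _ a ≠ ∑ t ∈ s, x t * y t := by
  intro h
  have hcoeff := congrArg (arrowCoeff hM a) h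
  rw [arrowCoeff_arrowElt_self, map_sum, Finset.sum_eq_zero fun t ht => by
    rw [arrowCoeff_mul, hx t ht, hy t ht, zero_mul, mul_zero, add_zero]] at hcoeff
  exact one_ne_zero hcoeff

/-- Otherwise `a` is an element of the projective annihilator of `c`, which is killed by `b`. By the
dual basis lemma `a` is then a sum of products of an element killed by `b` with one killing `c`. -/
theorem twoPath_not_mem_of_globalDimension_le_two
    (h : globalDimension (BoundQuiverAlgebra (pathIdeal k M)) ≤ (2 : ℕ)) {i j l m : V}
    {c : i ⟶ j} {a : j ⟶ l} {b : l ⟶ m} (hca : twoPath c a ∈ M) : twoPath a b ∉ M := by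
  intro hab
  set Λ := BoundQuiverAlgebra (pathIdeal k M)
  let P := LinearMap.ker (LinearMap.toSpanSingleton Λ Λ (arrowElt _ c))
  have hP : Module.Projective Λ P := projective_ker_of_globalDimension_le_two h _
  obtain ⟨s, hs⟩ := Module.projective_def.1 hP
  let a' : P := ⟨arrowElt _ a, arrowElt_mul_arrowElt_of_mem hca⟩
  have hba : (arrowElt _ b : Λ) • a' = 0 := Subtype.ext (arrowElt_mul_arrowElt_of_mem hab)
  have ha : arrowElt _ a = ∑ x ∈ (s a').support, s a' x * (x : Λ) := by
    have ha' := congrArg Subtype.val (hs a')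
    rw [Finsupp.linearCombination_apply, Finsupp.sum, AddSubmonoidClass.coe_finsetSum] at ha'
    exact ha'.symm
  refine arrowElt_ne_sum hM a _ _ _ (fun x _ => ?_) (fun x _ => ?_) ha
  · rw [← arrowCoeff_arrowElt_mul hM b, ← smul_eq_mul, ← Finsupp.smul_apply, ← map_smul, hba,
      map_zero, Finsupp.zero_apply, map_zero]
  · rw [← arrowCoeff_mul_arrowElt hM c, show (x : Λ) * arrowElt _ c = 0 from x.2, map_zero]

end BoundQuiver

/-! ### Weights -/

section Weight

open scoped TensorProduct

variable {k : Type u} [Field k] {V : Type} [Quiver.{0} V] [Fintype V] {M : Set (QPath V)}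
  (hM : ∀ p ∈ M, p.2.2.length = 2)

/-- The form `vertexCoeff hM i` as an element of `DΛ`. -/
def dualVertex (i : V) : DualBimodule k (BoundQuiverAlgebra (pathIdeal k M)) :=
  (vertexCoeff hM i).toLinearMap

/-- The form `arrowCoeff hM b` as an element of `DΛ`. -/
def dualArrow {i j : V} (b : i ⟶ j) : DualBimodule k (BoundQuiverAlgebra (pathIdeal k M)) :=
  arrowCoeff hM b

theorem arrowElt_smul_dualVertex {i j : V} (b : i ⟶ j) (l : V) :
    arrowElt (pathIdeal k M) b • dualVertex (k := k) hM l = 0 :=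
  LinearMap.ext fun x => (map_mul (vertexCoeff hM l) x _).trans <| by
    rw [vertexCoeff_arrowElt, mul_zero]; rfl

theorem arrowElt_smul_dualArrow {i j : V} (b : i ⟶ j) :
    arrowElt (pathIdeal k M) b • dualArrow (k := k) hM b = dualVertex hM j :=
  LinearMap.ext fun x => arrowCoeff_mul_arrowElt hM b x

/-- If the contractions of `D` are the commutators with `h`, then the weight of `i` is the
coefficient of `e_i` in `h ε_i`, where `ε_i` is the character at `i`. -/
theorem exists_weight {D : BoundQuiverAlgebra (pathIdeal k M) →ₗ[k]
    Env k (BoundQuiverAlgebra (pathIdeal k M))} {hD : IsDerivation D}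
    (hinner : (contractDerivation D hD).IsInner) :
    ∃ w : V → k, ∀ {i j : V} (b : i ⟶ j),
      vertexCoeff hM j (contract (dualVertex hM i) (D (arrowElt _ b))) = 0 ∧
      arrowCoeff hM b (contract (dualVertex hM i) (D (arrowElt _ b))) = w i ∧
      vertexCoeff hM j (contract (dualArrow hM b) (D (arrowElt _ b))) = -w j := by
  obtain ⟨h, hh⟩ := hinner
  refine ⟨fun i => vertexCoeff hM i (h (dualVertex hM i)), fun {i j} b => ?_⟩
  have hvertex : contract (dualVertex hM i) (D (arrowElt _ b)) =
      arrowElt _ b * h (dualVertex hM i) := by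
    rw [← contractDerivation_apply D hD, hh, arrowElt_smul_dualVertex, map_zero, sub_zero,
      smul_eq_mul]
  have harrow : contract (dualArrow hM b) (D (arrowElt _ b)) =
      arrowElt _ b * h (dualArrow hM b) - h (dualVertex hM j) := by
    rw [← contractDerivation_apply D hD, hh, arrowElt_smul_dualArrow, smul_eq_mul]
  refine ⟨?_, ?_, ?_⟩
  · rw [hvertex, map_mul, vertexCoeff_arrowElt, zero_mul]
  · rw [hvertex, arrowCoeff_arrowElt_mul]
  · rw [harrow, map_sub, map_mul, vertexCoeff_arrowElt, zero_mul, zero_sub]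

/-- A source of the quiver which is the tail of at most one arrow. -/
def IsLeafSource {V : Type*} [Quiver V] (i : V) : Prop :=
  Subsingleton (Quiver.Star i) ∧ IsEmpty (Quiver.Costar i)

/-- A sink of the quiver which is the head of at most one arrow. -/
def IsLeafSink {V : Type*} [Quiver V] (i : V) : Prop :=
  Subsingleton (Quiver.Costar i) ∧ IsEmpty (Quiver.Star i)

variable (hinner : ContractionsInner k (BoundQuiverAlgebra (pathIdeal k M)))
include hM hinner

theorem exists_weight_of_arrow {i j : V} (a : i ⟶ j)
    {x y : BoundQuiverAlgebra (pathIdeal k M)} (hx : vertexElt _ j * x = x)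
    (hy : y * vertexElt _ i = y)
    (hb : ∀ {l : V} (b : j ⟶ l), twoPath a b ∈ M → arrowElt _ b * x = 0)
    (hc : ∀ {l : V} (c : l ⟶ i), twoPath c a ∈ M → y * arrowElt _ c = 0) :
    ∃ w : V → k, vertexCoeff hM i y * vertexCoeff hM j x = 0 ∧
      vertexCoeff hM i y * arrowCoeff hM a x = w i ∧
      arrowCoeff hM a y * vertexCoeff hM j x = -w j ∧
      ∀ {p q : V} (b : p ⟶ q), (⟨p, q, b⟩ : Quiver.Total V) ≠ ⟨i, j, a⟩ → w p = 0 ∧ w q = 0 := by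
  obtain ⟨D, hD, hDa, hDb⟩ := exists_isDerivation_of_arrow hM a (n := x ⊗ₜ[k] MulOpposite.op y)
    (by rw [smul_eq_mul, Algebra.TensorProduct.tmul_mul_tmul, hx, one_mul])
    (by rw [smul_eq_mul, Algebra.TensorProduct.tmul_mul_tmul, ← MulOpposite.op_mul, hy, one_mul])
    (fun b h => by
      rw [smul_eq_mul, Algebra.TensorProduct.tmul_mul_tmul, hb b h, TensorProduct.zero_tmul])
    (fun c h => by
      rw [smul_eq_mul, Algebra.TensorProduct.tmul_mul_tmul, ← MulOpposite.op_mul, hc c h,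
        MulOpposite.op_zero, TensorProduct.tmul_zero])
  obtain ⟨w, hw⟩ := exists_weight hM (hinner D hD)
  have ha := hw a
  rw [hDa, contract_tmul, contract_tmul, map_smul, map_smul, map_smul] at ha
  refine ⟨w, ha.1, ha.2.1, ha.2.2, fun b hne => ?_⟩
  have hwb := hw b
  rw [hDb b hne, map_zero, map_zero, map_zero, map_zero, map_zero] at hwb
  exact ⟨hwb.2.1.symm, neg_eq_zero.1 hwb.2.2.symm⟩

theorem exists_twoPath_mem_of_contractionsInner {i j : V} (a : i ⟶ j) :
    (∃ (l : V) (c : l ⟶ i), twoPath c a ∈ M) ∨ ∃ (l : V) (b : j ⟶ l), twoPath a b ∈ M := by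
  by_contra! hno
  obtain ⟨w, hzero, -⟩ := exists_weight_of_arrow hM hinner a
    (vertexElt_mul_self _ j) (vertexElt_mul_self _ i)
    (fun b hb => (hno.2 _ b hb).elim) (fun c hc => (hno.1 _ c hc).elim)
  rw [vertexCoeff_vertexElt_self, vertexCoeff_vertexElt_self, one_mul] at hzero
  exact one_ne_zero hzero

theorem isLeafSource_of_contractionsInner {i j : V} {a : i ⟶ j}
    (ha : ∀ {l : V} (c : l ⟶ i), twoPath c a ∉ M) : IsLeafSource i := by
  obtain ⟨w, -, hwi, hwj, hw⟩ := exists_weight_of_arrow hM hinner a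
    (vertexElt_mul_arrowElt _ a) (vertexElt_mul_self _ i)
    (fun b hb => arrowElt_mul_arrowElt_of_mem hb) (fun c hc => (ha c hc).elim)
  rw [vertexCoeff_vertexElt_self, arrowCoeff_arrowElt_self, one_mul] at hwi
  rw [vertexCoeff_arrowElt, mul_zero, zero_eq_neg] at hwj
  have hi : w i ≠ 0 := hwi ▸ one_ne_zero
  have hout : ∀ t : Quiver.Star i, t = ⟨j, a⟩ := by
    rintro ⟨q, b⟩
    by_contra hne
    exact hi (hw b fun h => by cases h; exact hne rfl).1
  refine ⟨⟨fun t t' => (hout t).trans (hout t').symm⟩, ⟨fun ⟨l, c⟩ => ?_⟩⟩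
  exact hi (hw c fun h => by cases h; exact hi hwj).2

theorem isLeafSink_of_contractionsInner {i j : V} {a : i ⟶ j}
    (ha : ∀ {l : V} (b : j ⟶ l), twoPath a b ∉ M) : IsLeafSink j := by
  obtain ⟨w, -, hwi, hwj, hw⟩ := exists_weight_of_arrow hM hinner a
    (vertexElt_mul_self _ j) (arrowElt_mul_vertexElt _ a)
    (fun b hb => (ha b hb).elim) (fun c hc => arrowElt_mul_arrowElt_of_mem hc)
  rw [vertexCoeff_arrowElt, zero_mul] at hwi
  rw [vertexCoeff_vertexElt_self, arrowCoeff_arrowElt_self, one_mul] at hwj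
  have hj : w j ≠ 0 := neg_ne_zero.1 (hwj ▸ one_ne_zero)
  have hin : ∀ t : Quiver.Costar j, t = ⟨i, a⟩ := by
    rintro ⟨p, b⟩
    by_contra hne
    exact hj (hw b fun h => by cases h; exact hne rfl).2
  refine ⟨⟨fun t t' => (hin t).trans (hin t').symm⟩, ⟨fun ⟨l, c⟩ => ?_⟩⟩
  exact hj (hw c fun h => by cases h; exact hj hwi.symm).1

end Weight

/-! ### Stars -/

section Star

open Function

theorem surjective_obj_of_isCovering {U W : Type*} [Quiver U] [Quiver W] [Nonempty U]
    {φ : U ⥤q W} (hφ : φ.IsCovering)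
    (hconn : Subsingleton (Quiver.WeaklyConnectedComponent W)) : Surjective φ.obj := by
  obtain ⟨u⟩ := ‹Nonempty U›
  refine weaklyConnected_induction hconn (P := (· ∈ Set.range φ.obj)) (fun {i j} b => ⟨?_, ?_⟩)
    ⟨u, rfl⟩
  · rintro ⟨u, rfl⟩
    obtain ⟨t, ht⟩ := (hφ.star_bijective u).2 ⟨j, b⟩
    exact ⟨t.1, congrArg Sigma.fst ht⟩
  · rintro ⟨u, rfl⟩
    obtain ⟨t, ht⟩ := (hφ.costar_bijective u).2 ⟨i, b⟩
    exact ⟨t.1, congrArg Sigma.fst ht⟩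

theorem bijective_map_of_isCovering {U W : Type*} [Quiver U] [Quiver W] {φ : U ⥤q W}
    (hφ : φ.IsCovering) (hinj : Injective φ.obj) (u v : U) :
    Bijective (φ.map : (u ⟶ v) → (φ.obj u ⟶ φ.obj v)) := by
  refine ⟨hφ.map_injective, fun b => ?_⟩
  obtain ⟨⟨v', b'⟩, hb⟩ := (hφ.star_bijective u).2 ⟨φ.obj v, b⟩
  obtain rfl : v' = v := hinj (congrArg Sigma.fst hb)
  exact ⟨b', eq_of_heq (Sigma.mk.inj hb).2⟩

theorem nonempty_quiv_iso_of_isCovering {U W : Type} [Quiver.{0} U] [Quiver.{0} W] [Nonempty U]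
    {φ : U ⥤q W} (hφ : φ.IsCovering) (hinj : Injective φ.obj)
    (hconn : Subsingleton (Quiver.WeaklyConnectedComponent W)) :
    Nonempty (Quiv.of U ≅ Quiv.of W) :=
  ⟨Quiv.isoOfEquiv (Equiv.ofBijective φ.obj ⟨hinj, surjective_obj_of_isCovering hφ hconn⟩)
    fun u v => Equiv.ofBijective φ.map (bijective_map_of_isCovering hφ hinj u v)⟩

variable {V : Type} [Quiver.{0} V] {z : V} {r s : ℕ}

theorem injective_costar_fst (hin : ∀ c : Quiver.Costar z, IsLeafSource c.1) :
    Injective (Sigma.fst : Quiver.Costar z → V) := by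
  rintro ⟨i, c⟩ ⟨_, c'⟩ rfl
  have := (hin ⟨i, c⟩).1
  cases Subsingleton.elim (⟨z, c⟩ : Quiver.Star i) ⟨z, c'⟩
  rfl

theorem injective_star_fst (hout : ∀ b : Quiver.Star z, IsLeafSink b.1) :
    Injective (Sigma.fst : Quiver.Star z → V) := by
  rintro ⟨j, b⟩ ⟨_, b'⟩ rfl
  have := (hout ⟨j, b⟩).1
  cases Subsingleton.elim (⟨z, b⟩ : Quiver.Costar j) ⟨z, b'⟩
  rfl

/-- The morphism from a star quiver which sends the centre to `z` and has prescribed values on the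
arrows. -/
def starPrefunctor (α : Fin r → Quiver.Costar z) (β : Fin s → Quiver.Star z) :
    StarVertex r s ⥤q V where
  obj
    | .source i => (α i).1
    | .center => z
    | .sink j => (β j).1
  map
    | .a i => (α i).2
    | .b j => (β j).2

variable {α : Fin r → Quiver.Costar z} {β : Fin s → Quiver.Star z}

theorem starPrefunctor_isCovering (hα : Bijective α) (hβ : Bijective β)
    (hin : ∀ c : Quiver.Costar z, IsLeafSource c.1)
    (hout : ∀ b : Quiver.Star z, IsLeafSink b.1) : (starPrefunctor α β).IsCovering where
  star_bijective
    | .source i => by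
      have : Subsingleton (Quiver.Star ((starPrefunctor α β).obj (.source i))) := (hin (α i)).1
      exact ⟨fun | ⟨_, .a _⟩, ⟨_, .a _⟩, _ => rfl, fun t => ⟨⟨_, .a i⟩, Subsingleton.elim _ t⟩⟩
    | .center => by
      refine ⟨fun | ⟨_, .b j⟩, ⟨_, .b j'⟩, h => ?_, fun t => ?_⟩
      · cases hβ.1 (a₁ := j) (a₂ := j') h
        rfl
      · obtain ⟨j, rfl⟩ := hβ.2 t
        exact ⟨⟨_, .b j⟩, rfl⟩
    | .sink j => ⟨(nomatch ·), fun t => ((hout (β j)).2.false t).elim⟩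
  costar_bijective
    | .source i => ⟨(nomatch ·), fun t => ((hin (α i)).2.false t).elim⟩
    | .center => by
      refine ⟨fun | ⟨_, .a i⟩, ⟨_, .a i'⟩, h => ?_, fun t => ?_⟩
      · cases hα.1 (a₁ := i) (a₂ := i') h
        rfl
      · obtain ⟨i, rfl⟩ := hα.2 t
        exact ⟨⟨_, .a i⟩, rfl⟩
    | .sink j => by
      have : Subsingleton (Quiver.Costar ((starPrefunctor α β).obj (.sink j))) := (hout (β j)).1
      exact ⟨fun | ⟨_, .b _⟩, ⟨_, .b _⟩, _ => rfl, fun t => ⟨⟨_, .b j⟩, Subsingleton.elim _ t⟩⟩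

theorem starPrefunctor_obj_injective (hα : Injective α) (hβ : Injective β)
    (hin : ∀ c : Quiver.Costar z, IsLeafSource c.1)
    (hout : ∀ b : Quiver.Star z, IsLeafSink b.1) [Nonempty (Quiver.Costar z)]
    [Nonempty (Quiver.Star z)] : Injective (starPrefunctor α β).obj := by
  have ne_center_in (c : Quiver.Costar z) : c.1 ≠ z := fun h => by
    have := (hin c).2
    exact not_isEmpty_of_nonempty (Quiver.Costar z) (h ▸ this)
  have ne_center_out (b : Quiver.Star z) : b.1 ≠ z := fun h => by
    have := (hout b).2
    exact not_isEmpty_of_nonempty (Quiver.Star z) (h ▸ this)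
  have ne_in_out (c : Quiver.Costar z) (b : Quiver.Star z) : c.1 ≠ b.1 := fun h => by
    have := (hin c).2
    rw [h] at this
    exact this.false ⟨z, b.2⟩
  rintro (i | _ | j) (i' | _ | j') h
  · exact congrArg _ (hα (injective_costar_fst hin h))
  · exact (ne_center_in _ h).elim
  · exact (ne_in_out _ _ h).elim
  · exact (ne_center_in _ h.symm).elim
  · rfl
  · exact (ne_center_out _ h.symm).elim
  · exact (ne_in_out _ _ h.symm).elim
  · exact (ne_center_out _ h).elim
  · exact congrArg _ (hβ (injective_star_fst hout h))

theorem exists_iso_star [Finite V] (hconn : Subsingleton (Quiver.WeaklyConnectedComponent V))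
    (hin : ∀ c : Quiver.Costar z, IsLeafSource c.1)
    (hout : ∀ b : Quiver.Star z, IsLeafSink b.1) [Nonempty (Quiver.Costar z)]
    [Nonempty (Quiver.Star z)] :
    ∃ r s : ℕ, 1 ≤ r ∧ 1 ≤ s ∧ Nonempty (Quiv.of V ≅ Quiv.of (StarVertex r s)) := by
  have := Finite.of_injective _ (injective_costar_fst hin)
  have := Finite.of_injective _ (injective_star_fst hout)
  let α := (Finite.equivFin (Quiver.Costar z)).symm
  let β := (Finite.equivFin (Quiver.Star z)).symm
  have : Nonempty (StarVertex (Nat.card (Quiver.Costar z)) (Nat.card (Quiver.Star z))) :=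
    ⟨.center⟩
  obtain ⟨e⟩ := nonempty_quiv_iso_of_isCovering
    (starPrefunctor_isCovering α.bijective β.bijective hin hout)
    (starPrefunctor_obj_injective α.injective β.injective hin hout) hconn
  exact ⟨_, _, Nat.card_pos, Nat.card_pos, ⟨e.symm⟩⟩

end Star

/-! ### Isomorphic quivers -/

section Transport

variable {k : Type u} [Field k] {V W : Type} [Quiver.{0} V] [Quiver.{0} W] [Fintype V] [Fintype W]

/-- The tautological representation of `W` in a bound quiver algebra, restricted to `V` along a
morphism which is bijective on vertices. -/
def mapRep (F : V ⥤q W) (hF : Function.Bijective F.obj) (J : TwoSidedIdeal (PathAlgebra k W)) :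
    PathRep V (BoundQuiverAlgebra J) where
  vertex i := vertexElt J (F.obj i)
  complete := (CompleteOrthogonalIdempotents.equiv (Equiv.ofBijective F.obj hF)).2
    (completeOrthogonalIdempotents_vertexElt J)
  arrow b := arrowElt J (F.map b)
  vertex_mul_arrow b := vertexElt_mul_arrowElt J (F.map b)
  arrow_mul_vertex b := arrowElt_mul_vertexElt J (F.map b)

variable {M : Set (QPath V)} {N : Set (QPath W)}

/-- The homomorphism of quadratic monomial algebras induced by a morphism of quivers which is
bijective on vertices and preserves the relations. -/
def mapBound (F : V ⥤q W) (hF : Function.Bijective F.obj) (hM : ∀ p ∈ M, p.2.2.length = 2)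
    (hFM : ∀ {i j l : V} (a : i ⟶ j) (b : j ⟶ l), twoPath a b ∈ M →
      twoPath (F.map a) (F.map b) ∈ N) :
    BoundQuiverAlgebra (pathIdeal k M) →ₐ[k] BoundQuiverAlgebra (pathIdeal k N) :=
  (mapRep F hF (pathIdeal k N)).liftBound hM fun a b h =>
    arrowElt_mul_arrowElt_of_mem (hFM a b h)

section

variable {F : V ⥤q W} (hF : Function.Bijective F.obj) (hM : ∀ p ∈ M, p.2.2.length = 2)
  (hFM : ∀ {i j l : V} (a : i ⟶ j) (b : j ⟶ l), twoPath a b ∈ M →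
    twoPath (F.map a) (F.map b) ∈ N)

theorem mapBound_vertexElt (i : V) :
    mapBound F hF hM hFM (vertexElt (pathIdeal k M) i) = vertexElt _ (F.obj i) :=
  (mapRep F hF _).liftBound_vertexElt hM
    (fun a b h => arrowElt_mul_arrowElt_of_mem (hFM a b h)) i

theorem mapBound_arrowElt {i j : V} (b : i ⟶ j) :
    mapBound F hF hM hFM (arrowElt (pathIdeal k M) b) = arrowElt _ (F.map b) :=
  (mapRep F hF _).liftBound_arrowElt hM
    (fun a b h => arrowElt_mul_arrowElt_of_mem (hFM a b h)) b

theorem mapBound_comp_mapBound {G : W ⥤q V} (hG : Function.Bijective G.obj)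
    (hN : ∀ p ∈ N, p.2.2.length = 2)
    (hGN : ∀ {i j l : W} (a : i ⟶ j) (b : j ⟶ l), twoPath a b ∈ N →
      twoPath (G.map a) (G.map b) ∈ M) (h : F ⋙q G = 𝟭q V) :
    (mapBound G hG hN hGN).comp (mapBound F hF hM hFM) =
      AlgHom.id k (BoundQuiverAlgebra (pathIdeal k M)) := by
  refine boundQuiverAlgebra_algHom_ext (fun i => ?_) fun b => ?_
  · rw [AlgHom.comp_apply, mapBound_vertexElt, mapBound_vertexElt]
    change vertexElt _ ((F ⋙q G).obj i) = vertexElt _ i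
    rw [h]
    rfl
  · rw [AlgHom.comp_apply, mapBound_arrowElt, mapBound_arrowElt]
    change arrowElt _ ((F ⋙q G).map b) = arrowElt _ b
    rw [h]
    rfl

end

theorem exists_boundQuiverAlgebra_algEquiv (e : Quiv.of V ≅ Quiv.of W)
    (hM : ∀ p ∈ M, p.2.2.length = 2) :
    ∃ N : Set (QPath W), (∀ p ∈ N, p.2.2.length = 2) ∧
      Nonempty (BoundQuiverAlgebra (pathIdeal k M) ≃ₐ[k] BoundQuiverAlgebra (pathIdeal k N)) := by
  let F : V ⥤q W := e.hom
  let G : W ⥤q V := e.inv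
  have hFG : F ⋙q G = 𝟭q V := e.hom_inv_id
  have hGF : G ⋙q F = 𝟭q W := e.inv_hom_id
  have hF : Function.Bijective F.obj := Function.bijective_iff_has_inverse.2
    ⟨G.obj, Prefunctor.congr_obj hFG, Prefunctor.congr_obj hGF⟩
  have hG : Function.Bijective G.obj := Function.bijective_iff_has_inverse.2
    ⟨F.obj, Prefunctor.congr_obj hGF, Prefunctor.congr_obj hFG⟩
  let N : Set (QPath W) := {p | p.2.2.length = 2 ∧ (⟨_, _, G.mapPath p.2.2⟩ : QPath V) ∈ M}
  have hN : ∀ p ∈ N, p.2.2.length = 2 := fun _ hp => hp.1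
  have hFM {i j l : V} (a : i ⟶ j) (b : j ⟶ l) (h : twoPath a b ∈ M) :
      twoPath (F.map a) (F.map b) ∈ N := by
    refine ⟨rfl, ?_⟩
    change twoPath ((F ⋙q G).map a) ((F ⋙q G).map b) ∈ M
    rwa [hFG]
  have hGN {i j l : W} (a : i ⟶ j) (b : j ⟶ l) (h : twoPath a b ∈ N) :
      twoPath (G.map a) (G.map b) ∈ M := h.2
  exact ⟨N, hN, ⟨AlgEquiv.ofAlgHom (mapBound F hF hM hFM) (mapBound G hG hN hGN)
    (mapBound_comp_mapBound hG hN hGN hF hM hFM hGF)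
    (mapBound_comp_mapBound hF hM hFM hG hN hGN hFG)⟩⟩

end Transport

/-! ### Quadratic monomial algebras of global dimension two -/

section Main

variable {k : Type u} [Field k]

theorem length_lt_three_of_star {r s : ℕ} {i j : StarVertex r s} (p : Quiver.Path i j) :
    p.length < 3 :=
  match p with
  | .nil => Nat.zero_lt_succ _
  | .cons .nil _ => Nat.lt_succ_of_lt (Nat.lt_succ_self _)
  | .cons (.cons .nil _) _ => Nat.lt_succ_self _
  | .cons (.cons (.cons _ (.a _)) b) c => nomatch b, c
  | .cons (.cons (.cons _ (.b _)) b) _ => nomatch b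

theorem isAdmissible_pathIdeal_star {r s : ℕ} {M : Set (QPath (StarVertex r s))}
    (hM : ∀ p ∈ M, p.2.2.length = 2) : IsAdmissible (pathIdeal k M) := by
  refine ⟨TwoSidedIdeal.span_mono (Set.image_mono hM), 3, by decide, TwoSidedIdeal.span_le.2 ?_⟩
  rintro _ ⟨p, hp, rfl⟩
  exact ((length_lt_three_of_star p.2.2).ne hp).elim

variable {V : Type} [Quiver.{0} V] [Fintype V]

theorem exists_iso_star_of_contractionsInner
    (hconn : Subsingleton (Quiver.WeaklyConnectedComponent V))
    {I : TwoSidedIdeal (PathAlgebra k V)} (hquad : IsQuadraticMonomial I)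
    (hdim : globalDimension (BoundQuiverAlgebra I) = 2)
    (hinner : ContractionsInner k (BoundQuiverAlgebra I)) :
    ∃ r s : ℕ, 1 ≤ r ∧ 1 ≤ s ∧ Nonempty (Quiv.of V ≅ Quiv.of (StarVertex r s)) := by
  obtain ⟨M, hM, rfl⟩ := hquad
  have hleaf {i j : V} (a : i ⟶ j) : IsLeafSource i ∨ IsLeafSink j := by
    by_cases h : ∃ (l : V) (c : l ⟶ i), twoPath c a ∈ M
    · obtain ⟨l, c, hca⟩ := h
      exact .inr <| isLeafSink_of_contractionsInner hM hinner fun b =>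
        twoPath_not_mem_of_globalDimension_le_two hM hdim.le hca
    · exact .inl <| isLeafSource_of_contractionsInner hM hinner fun c hca => h ⟨_, c, hca⟩
  have hstar {i z j : V} (a : i ⟶ z) (b : z ⟶ j) :
      ∃ r s : ℕ, 1 ≤ r ∧ 1 ≤ s ∧ Nonempty (Quiv.of V ≅ Quiv.of (StarVertex r s)) :=
    have : Nonempty (Quiver.Costar z) := ⟨⟨i, a⟩⟩
    have : Nonempty (Quiver.Star z) := ⟨⟨j, b⟩⟩
    exists_iso_star hconn (fun c => (hleaf c.2).resolve_right fun h => h.2.false ⟨j, b⟩)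
      fun c => (hleaf c.2).resolve_left fun h => h.2.false ⟨i, a⟩
  obtain ⟨i, j, ⟨a⟩⟩ := exists_arrow_of_globalDimension_pos hconn (two_pos.trans_eq hdim.symm)
  obtain ⟨l, c, -⟩ | ⟨l, b, -⟩ := exists_twoPath_mem_of_contractionsInner hM hinner a
  · exact hstar c a
  · exact hstar a b

end Main

end StarCor

end

theorem mainTheorem4_general {k : Type u} [Field k] {V : Type} [Quiver.{0} V] [Fintype V]
    (hconn : Subsingleton (Quiver.WeaklyConnectedComponent V))
    (I : TwoSidedIdeal (StarCor.PathAlgebra k V))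
    (hquad : StarCor.IsQuadraticMonomial I) :
    (StarCor.globalDimension (StarCor.BoundQuiverAlgebra I) = 2 →
      Subsingleton (StarCor.ExtEnv k (StarCor.BoundQuiverAlgebra I) 1) →
      ∃ r s : ℕ, 1 ≤ r ∧ 1 ≤ s ∧
        Nonempty (Quiv.of V ≅ Quiv.of (StarCor.StarVertex r s))) ∧
    (StarCor.IsNHereditary k (StarCor.BoundQuiverAlgebra I) 2 →
      ∃ r s : ℕ, 1 ≤ r ∧ 1 ≤ s ∧
        Nonempty (Quiv.of V ≅ Quiv.of (StarCor.StarVertex r s)) ∧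
        ∃ J : TwoSidedIdeal (StarCor.PathAlgebra k (StarCor.StarVertex r s)),
          StarCor.IsAdmissible J ∧ StarCor.IsQuadraticMonomial J ∧
          Nonempty (StarCor.BoundQuiverAlgebra I ≃ₐ[k] StarCor.BoundQuiverAlgebra J)) := by
  refine ⟨fun hdim hext => StarCor.exists_iso_star_of_contractionsInner hconn hquad hdim
    (StarCor.contractionsInner_of_subsingleton_ext hext), fun h => ?_⟩
  obtain ⟨r, s, hr, hs, ⟨e⟩⟩ := StarCor.exists_iso_star_of_contractionsInner hconn hquad h.2.1
    (StarCor.contractionsInner_of_isNHereditary (by decide) h)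
  obtain ⟨M, hM, rfl⟩ := hquad
  obtain ⟨N, hN, hequiv⟩ := StarCor.exists_boundQuiverAlgebra_algEquiv (k := k) e hM
  exact ⟨r, s, hr, hs, ⟨e⟩, StarCor.pathIdeal k N, StarCor.isAdmissible_pathIdeal_star hN,
    ⟨N, hN, rfl⟩, hequiv⟩

theorem mainTheorem4 {k : Type u} [Field k] [IsAlgClosed k]
    {V : Type} [Quiver.{0} V] [Fintype V] [∀ i j : V, Finite (i ⟶ j)] [Nonempty V]
    (hconn : Subsingleton (Quiver.WeaklyConnectedComponent V))
    (I : TwoSidedIdeal (StarCor.PathAlgebra k V))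
    (hadm : StarCor.IsAdmissible I) (hquad : StarCor.IsQuadraticMonomial I) :
    (StarCor.globalDimension (StarCor.BoundQuiverAlgebra I) = 2 →
      Subsingleton (StarCor.ExtEnv k (StarCor.BoundQuiverAlgebra I) 1) →
      ∃ r s : ℕ, 1 ≤ r ∧ 1 ≤ s ∧
        Nonempty (Quiv.of V ≅ Quiv.of (StarCor.StarVertex r s))) ∧
    (StarCor.IsNHereditary k (StarCor.BoundQuiverAlgebra I) 2 →
      ∃ r s : ℕ, 1 ≤ r ∧ 1 ≤ s ∧
        Nonempty (Quiv.of V ≅ Quiv.of (StarCor.StarVertex r s)) ∧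
        ∃ J : TwoSidedIdeal (StarCor.PathAlgebra k (StarCor.StarVertex r s)),
          StarCor.IsAdmissible J ∧ StarCor.IsQuadraticMonomial J ∧
          Nonempty (StarCor.BoundQuiverAlgebra I ≃ₐ[k] StarCor.BoundQuiverAlgebra J)) :=
  mainTheorem4_general hconn I hquad
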